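/- **Setting.** Let $d\ge 1$. A finite non-empty set $\mathcal D\subset U(d)$ of $K$ unitary matrices is a *unitary 2-design* if for every operator $\rho$ on $\mathbb C^d\otimes\mathbb C^d$ $$\frac1K\sum_{W\in\mathcal D}(W\otimes W)\,\rho\,(W\otimes W)^\dagger=\int_{U(d)}(W\otimes W)\,\rho\,(W\otimes W)^\dagger\,dW ,$$ where $dW$ is the normalized Haar measure. Its *frame potential* is $\mathcal P(\mathcal D)=K^{-2}\sum_{W,W'\in\mathcal D}|\operatorname{tr}W^\dagger W'|^4$. For a unitary representation $U:g\mapsto U_g$ of a finite group $G$ on $\mathbb C^d$, let $Z(U)$ be the set of those $U_g$ that commute with every $U_h$. A *group design induced by $U$*, written $\mathcal D_U$, is a transversal of $\{U_g \mid g\in G\}/Z(U)$: a subset of $\{U_g\mid g\in G\}$ that contains exactly one element of each coset $U_gZ(U)$. For complex functions on $G$ put $\langle\zeta,\chi\rangle=|G|^{-1}\sum_g\overline{\zeta(g)}\chi(g)$ and $\|\zeta\|^2=\langle\zeta,\zeta\rangle$. **Theorem (Group designs).** Let $G$ be a finite group, let $U$ be a unitary representation of $G$ on $\mathbb C^d$,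 $d\ge1$, with character $\chi$, and let $\mathcal D_U$ be any group design induced by $U$. If $d\ge 2$, the following are equivalent: 1. $\mathcal D_U$ is a unitary 2-design. 2. The representation $U^{(2)}:g\mapsto U_g\otimes U_g$ has no more than two irreducible components, counted with multiplicity. 3. The character $\zeta_{U^{(2)}}$ of $U^{(2)}$ satisfies $\|\zeta_{U^{(2)}}\|^2=2$. 4. Both $\chi_S(g)=\tfrac12(\chi(g)^2+\chi(g^2))$ and $\chi_A(g)=\tfrac12(\chi(g)^2-\chi(g^2))$ are irreducible characters of $G$. Further: 5. If $d\ge2$ and $\mathcal D_U$ is a unitary 2-design, then $|\mathcal D_U|$ is a multiple of $d$, of $\tfrac12d(d+1)$ and of $\tfrac12d(d-1)$. 6. Let $V$ be a unitary representation on $\mathbb C^d$ of a finite group $H$ with $\{V_h\mid h\in H\}\supseteq\{U_g\mid g\in G\}$. Then $\mathcal P(\{V_h\mid h\in H\})\le\mathcal P(\{U_g\mid g\in G\})$. If moreover $V$ is irreducible (in particular, if $U$ is irreducible), then also $\mathcal P(\mathcal D_V)\le\mathcal P(\mathcal D_U)$ for every group design $\mathcal D_V$ induced by $V$. 7. The frame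 potential of the matrix group $\{U_g\mid g\in G\}$ is an integer. If $U$ is irreducible, then $\mathcal P(\mathcal D_U)$ is an integer as well. 8. If $\mathcal D_U$ is a unitary 2-design, then $U$ is irreducible. 9. If $d>2$ and all the matrices $U_g$ are real, or, more generally, $\chi$ is real-valued, then $\mathcal D_U$ is not a unitary 2-design. -/

import Mathlib

open MeasureTheory
open scoped Matrix Kronecker ComplexConjugate

noncomputable section

namespace GroupDesign

/-- The unitary group `U(d)`, as a group of complex `d × d` matrices. -/
abbrev UGroup (d : ℕ) : Type := Matrix.unitaryGroup (Fin d) ℂ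

instance (d : ℕ) : CompactSpace (UGroup d) := by
  refine isCompact_iff_compactSpace.mp ?_
  have hb : IsCompact (Set.univ.pi fun _ : Fin d =>
      Set.univ.pi fun _ : Fin d => Metric.closedBall (0 : ℂ) 1) :=
    isCompact_univ_pi fun _ => isCompact_univ_pi fun _ => isCompact_closedBall 0 1
  refine IsCompact.of_isClosed_subset hb ?_ ?_
  · have h1 : IsClosed {A : Matrix (Fin d) (Fin d) ℂ | star A * A = 1} :=
      isClosed_eq (by fun_prop) continuous_const
    convert h1 using 1
    ext A
    exact Matrix.mem_unitaryGroup_iff'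
  · intro A hA i _ j _
    simpa using entry_norm_bound_of_unitary hA i j

/-- `U(d)` carries its Borel σ-algebra. -/
instance (d : ℕ) : MeasurableSpace (UGroup d) := borel _

instance (d : ℕ) : BorelSpace (UGroup d) := ⟨rfl⟩

/-- The normalized Haar measure `dU` of `U(d)`. -/
def haarU (d : ℕ) : Measure (UGroup d) := Measure.haarMeasure ⊤

instance (d : ℕ) : IsProbabilityMeasure (haarU d) := ⟨Measure.haarMeasure_self⟩

/-- The matrix of `U ⊗ U` on `ℂ^d ⊗ ℂ^d`. -/
def tensorSq {d : ℕ} (U : UGroup d) : Matrix (Fin d × Fin d) (Fin d × Fin d) ℂ :=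
  (U : Matrix (Fin d) (Fin d) ℂ) ⊗ₖ (U : Matrix (Fin d) (Fin d) ℂ)

/-- A finite set `D` of `K` unitaries is a unitary 2-design: it is non-empty and, for every
operator `ρ` on `ℂ^d ⊗ ℂ^d`,
`(1/K) ∑_{U ∈ D} (U ⊗ U) ρ (U ⊗ U)† = ∫_{U(d)} (U ⊗ U) ρ (U ⊗ U)† dU`.
The integral of the (continuous, bounded) matrix-valued function is taken entry by entry. -/
def IsUnitaryTwoDesign {d : ℕ} (D : Finset (UGroup d)) : Prop :=
  D.Nonempty ∧
  ∀ (ρ : Matrix (Fin d × Fin d) (Fin d × Fin d) ℂ) (i j : Fin d × Fin d),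
    (D.card : ℂ)⁻¹ * ∑ U ∈ D, (tensorSq U * ρ * (tensorSq U)ᴴ) i j
      = ∫ U : UGroup d, (tensorSq U * ρ * (tensorSq U)ᴴ) i j ∂(haarU d)

/-- The frame potential `(1/K²) ∑_{U, U' ∈ D} |tr (U† U')|⁴` of a finite set of `K` unitaries. -/
def framePotential {d : ℕ} (D : Finset (UGroup d)) : ℝ :=
  (∑ U ∈ D, ∑ U' ∈ D,
    ‖Matrix.trace ((U : Matrix (Fin d) (Fin d) ℂ)ᴴ * (U' : Matrix (Fin d) (Fin d) ℂ))‖ ^ 4)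
    / (D.card : ℝ) ^ 2

section Rep

variable {G : Type*} [Group G] {d : ℕ}

/-- The representation on `ℂ^d` given by a homomorphism into `U(d)`. -/
def rep (U : G →* UGroup d) : Representation ℂ G (Fin d → ℂ) where
  toFun g := Matrix.toLin' (U g : Matrix (Fin d) (Fin d) ℂ)
  map_one' := by simp [Module.End.one_eq_id]
  map_mul' g h := by simp [Matrix.toLin'_mul, Module.End.mul_eq_comp]

/-- The representation `U^(2) : g ↦ U_g ⊗ U_g` on `ℂ^d ⊗ ℂ^d`. -/
def rep2 (U : G →* UGroup d) : Representation ℂ G (TensorProduct ℂ (Fin d → ℂ) (Fin d → ℂ)) :=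
  (rep U).tprod (rep U)

/-- `ρ` is the direct sum of `n` irreducible subrepresentations, i.e. `ρ` has `n` irreducible
components, counted with multiplicity. -/
def HasIrreducibleComponents {V : Type*} [AddCommGroup V] [Module ℂ V]
    (ρ : Representation ℂ G V) (n : ℕ) : Prop :=
  ∃ W : Fin n → Subrepresentation ρ,
    DirectSum.IsInternal (fun i => (W i).toSubmodule) ∧
      ∀ i, (W i).toRepresentation.IsIrreducible

/-- The scalar product `⟨ζ, χ⟩ = |G|⁻¹ ∑_g conj (ζ g) χ g` of complex functions on `G`. -/
def charInner [Fintype G] (ζ χ : G → ℂ) : ℂ :=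
  (Fintype.card G : ℂ)⁻¹ * ∑ g, conj (ζ g) * χ g

/-- `χ` is the character of an irreducible finite-dimensional complex representation. -/
def IsIrreducibleCharacter (χ : G → ℂ) : Prop :=
  ∃ (n : ℕ) (ρ : Representation ℂ G (Fin n → ℂ)), ρ.IsIrreducible ∧ ρ.character = χ

/-- `χ_S g = (χ(g)² + χ(g²)) / 2`. -/
def symSquare (χ : G → ℂ) (g : G) : ℂ := (χ g ^ 2 + χ (g ^ 2)) / 2

/-- `χ_A g = (χ(g)² - χ(g²)) / 2`. -/
def altSquare (χ : G → ℂ) (g : G) : ℂ := (χ g ^ 2 - χ (g ^ 2)) / 2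

/-- The matrix group `{U_g | g ∈ G}`, as a finite set of unitaries. -/
def matrixGroup [Finite G] (U : G →* UGroup d) : Finset (UGroup d) :=
  (Set.finite_range U).toFinset

/-- The center `Z(U)`: the matrices `U_g` that commute with every `U_h`. -/
def repCenter (U : G →* UGroup d) : Set (UGroup d) :=
  {z | z ∈ Set.range U ∧ ∀ h : G, z * U h = U h * z}

/-- `D` is a group design induced by `U`: a transversal of `{U_g | g ∈ G} / Z(U)`, i.e. a set of
elements of `{U_g | g ∈ G}` that meets each coset `U_g Z(U)` in exactly one element. -/
def IsInducedBy (D : Finset (UGroup d)) (U : G →* UGroup d) : Prop :=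
  (∀ x ∈ D, x ∈ Set.range U) ∧
    ∀ g : G, ∃! x : UGroup d, x ∈ D ∧ ∃ z ∈ repCenter U, x = U g * z

end Rep

end GroupDesign

end

/-! Everything is governed by the commutant of the matrices `U g ⊗ U g`. Its dimension is ‖ζ‖², with
ζ the character of the tensor square, and it contains 1 and the flip F, which are independent for d
≥ 2. By Schur-Weyl duality (`exists_eq_smul_add_smul_swapMatrix`) the operators commuting with V ⊗ V
for every V in U(d) are exactly the combinations of 1 and F. An operator in the commutant is fixed
by averaging over D; if D is a 2-design, it is therefore fixed by the Haar twirl and is such a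
combination. Conversely, if the commutant is spanned by 1 and F, the Haar twirl fixes the group
average of X, while invariance of Haar measure sends that average to the twirl of X. So, for d ≥ 2,
D is a design exactly when ‖ζ‖² = 2.

The eigenspaces of F for 1 and -1 are the symmetric and alternating squares. For d ≥ 2 they are
non-zero and of different dimensions, so ‖ζ‖² = 2 means that both are irreducible. Having at most
two components means the same, because the lattice of subrepresentations is modular.

If A commutes with every `U g`, then A ⊗ 1 lies in the commutant; when this is spanned by 1 and F, A
is a scalar. Hence a design forces U to be irreducible. For irreducible U the center Z(U) consists
of phases, and phase-invariant functions have the same average over D as over G. In particular the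
frame potential of D is then ‖ζ‖², as it always is for the matrix group.

The kernel |tr x†y|⁴ is positive semidefinite with constant row sums on a group, so uniform weights
minimize its energy; this compares frame potentials. Divisibility is `finrank_dvd_card`, applied to
U and to both squares. If χ is real, then ⟨ζ, 1⟩ = ⟨χ, χ⟩ = 1 puts a trivial component into the
tensor square, whereas for d > 2 both squares of a design are irreducible of dimension above 1. -/

namespace GroupDesign

open Representation Module

/-! ### Lattice of subrepresentations and Schur's lemma -/

section Irreducibility

variable {G V : Type*} [Group G] [AddCommGroup V] [Module ℂ V]

/-- The order-theoretic form of irreducibility of a subrepresentation. -/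
theorem isAtom_iff_isIrreducible {ρ : Representation ℂ G V} (σ : Subrepresentation ρ) :
    IsAtom σ ↔ σ.toRepresentation.IsIrreducible := by
  -- `up` and `down` identify the subrepresentations of σ with those of ρ lying below σ.
  let up : Subrepresentation σ.toRepresentation → Subrepresentation ρ := fun τ =>
    ⟨τ.toSubmodule.map σ.toSubmodule.subtype, by
      rintro g _ ⟨v, hv, rfl⟩
      exact ⟨_, τ.apply_mem_toSubmodule g hv, rfl⟩⟩
  let down : Subrepresentation ρ → Subrepresentation σ.toRepresentation := fun τ =>
    ⟨τ.toSubmodule.comap σ.toSubmodule.subtype, fun g v hv => τ.apply_mem_toSubmodule g hv⟩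
  have hup : ∀ τ, up τ ≤ σ := by
    rintro τ _ ⟨v, hv, rfl⟩
    exact v.2
  have hdu : ∀ τ, down (up τ) = τ := fun τ => Subrepresentation.toSubmodule_injective
    (Submodule.comap_map_eq_of_injective σ.toSubmodule.injective_subtype _)
  have hud : ∀ τ, τ ≤ σ → up (down τ) = τ := fun τ h => Subrepresentation.toSubmodule_injective
    (by
      change Submodule.map _ (Submodule.comap _ _) = _
      rw [Submodule.map_comap_subtype]
      exact inf_eq_right.2 h)
  have hbot : up ⊥ = ⊥ := Subrepresentation.toSubmodule_injective (Submodule.map_bot _)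
  have htop : up ⊤ = σ := Subrepresentation.toSubmodule_injective (Submodule.map_subtype_top _)
  have hupinj : Function.Injective up := Function.LeftInverse.injective hdu
  constructor
  · intro h
    refine { exists_pair_ne := ⟨⊥, ⊤, fun e => h.1 ?_⟩, eq_bot_or_eq_top := fun τ => ?_ }
    · rw [← htop, ← e, hbot]
    · rcases h.le_iff.1 (hup τ) with h1 | h1
      · exact Or.inl (hupinj (h1.trans hbot.symm))
      · exact Or.inr (hupinj (h1.trans htop.symm))
  · intro h
    refine ⟨fun e => bot_ne_top (hupinj (hbot.trans (e.symm.trans htop.symm))), fun τ hτ => ?_⟩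
    rcases eq_bot_or_eq_top (down τ) with h1 | h1
    · rw [← hud τ hτ.le, h1, hbot]
    · exact absurd (by rw [← hud τ hτ.le, h1, htop]) hτ.ne

/-- In a modular lattice whose top element is the join of two complementary atoms, an element
that is neither bottom nor top is an atom. -/
theorem isAtom_of_isCompl_isAtom {α : Type*} [Lattice α] [BoundedOrder α] [IsModularLattice α]
    {a b s : α} (ha : IsAtom a) (hb : IsAtom b) (hab : IsCompl a b) (h0 : s ≠ ⊥) (h1 : s ≠ ⊤) :
    IsAtom s := by
  have hco : IsCoatom a := hab.isCoatom_iff_isAtom.2 hb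
  refine ⟨h0, fun t ht => ?_⟩
  by_cases has : a ≤ s
  · have : a = s := by
      by_contra hne
      exact h1 (hco.2 s (lt_of_le_of_ne has hne))
    exact ha.2 t (this ▸ ht)
  · by_contra ht0
    -- Since a is also a coatom, every non-zero r below s is a complement of a; modularity forbids
    -- two distinct comparable complements.
    have key : ∀ r, r ≤ s → r ≠ ⊥ → r ⊓ a = ⊥ ∧ r ⊔ a = ⊤ := by
      intro r hr hr0
      have h2 : r ⊓ a = ⊥ := by
        rcases ha.le_iff.1 (inf_le_right : r ⊓ a ≤ a) with h | h
        · exact h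
        · exact absurd ((inf_eq_right.1 h).trans hr) has
      refine ⟨h2, hco.2 _ (lt_of_le_of_ne le_sup_right fun e => hr0 ?_)⟩
      rw [← h2]
      exact (inf_eq_left.2 (sup_eq_right.1 e.symm)).symm
    obtain ⟨hs1, hs2⟩ := key s le_rfl h0
    obtain ⟨ht1, ht2⟩ := key t ht.le ht0
    exact ht.ne (eq_of_le_of_inf_le_of_sup_le (z := a) ht.le (by rw [hs1, ht1]) (by rw [hs2, ht2]))

instance {ρ : Representation ℂ G V} : IsModularLattice (Subrepresentation ρ) where
  sup_inf_le_assoc_of_le := fun {x} y z h =>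
    IsModularLattice.sup_inf_le_assoc_of_le (α := Submodule ℂ V) (x := x.toSubmodule)
      y.toSubmodule (z := z.toSubmodule) h

theorem isCompl_toSubmodule_iff {ρ : Representation ℂ G V} {σ τ : Subrepresentation ρ} :
    IsCompl σ.toSubmodule τ.toSubmodule ↔ IsCompl σ τ := by
  rw [isCompl_iff, isCompl_iff, disjoint_iff, disjoint_iff, codisjoint_iff, codisjoint_iff,
    ← Subrepresentation.toSubmodule_inf, ← Subrepresentation.toSubmodule_sup]
  exact and_congr (Subrepresentation.toSubmodule_injective.eq_iff (b := (⊥ : Subrepresentation ρ)))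
    (Subrepresentation.toSubmodule_injective.eq_iff (b := (⊤ : Subrepresentation ρ)))

/-- If a representation has at most two irreducible components, then each of two non-zero
complementary subrepresentations is irreducible. -/
theorem HasIrreducibleComponents.isIrreducible_of_isCompl {ρ : Representation ℂ G V} {n : ℕ}
    (hn : n ≤ 2) (h : HasIrreducibleComponents ρ n) {σ τ : Subrepresentation ρ}
    (hc : IsCompl σ τ) (hσ : σ ≠ ⊥) (hτ : τ ≠ ⊥) : σ.toRepresentation.IsIrreducible := by
  obtain ⟨W, hW, hirr⟩ := h
  have hatom : ∀ i, IsAtom (W i) := fun i => (isAtom_iff_isIrreducible _).2 (hirr i)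
  have hσ1 : σ ≠ ⊤ := fun e => hτ (by simpa [e] using hc.inf_eq_bot)
  rw [← isAtom_iff_isIrreducible]
  have hsup := hW.submodule_iSup_eq_top
  -- With no component the space is zero, and with one the representation is irreducible; neither
  -- leaves room for a proper non-zero σ.
  interval_cases n
  · rw [iSup_of_empty] at hsup
    refine absurd (Subrepresentation.toSubmodule_injective (a₁ := σ) (a₂ := ⊥) ?_) hσ
    exact eq_bot_iff.2 (hsup ▸ le_top)
  · have htop : W 0 = ⊤ := Subrepresentation.toSubmodule_injective (by
      simpa using! hsup)
    have := (hatom 0).le_iff.1 (htop ▸ le_top : σ ≤ W 0)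
    exact absurd this (by simp [htop, hσ, hσ1])
  · have h2 : IsCompl (W 0) (W 1) := isCompl_toSubmodule_iff.1
      ((DirectSum.isInternal_submodule_iff_isCompl _ (i := (0 : Fin 2)) (j := 1) (by decide)
        (by ext i; fin_cases i <;> simp)).1 hW)
    exact isAtom_of_isCompl_isAtom (hatom 0) (hatom 1) h2 hσ hσ1

theorem exists_eq_smul_id_of_commute [FiniteDimensional ℂ V] {ρ : Representation ℂ G V}
    (h : ρ.IsIrreducible) (f : V →ₗ[ℂ] V)
    (hf : ∀ g, f ∘ₗ ρ g = ρ g ∘ₗ f) : ∃ c : ℂ, f = c • LinearMap.id := by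
  obtain ⟨c, hc⟩ := (IsIrreducible.algebraMap_intertwiningMap_bijective_of_isAlgClosed
    (ρ := ρ)).2 ⟨f, hf⟩
  refine ⟨c, ?_⟩
  ext v
  simpa using! (congrArg (fun f : IntertwiningMap ρ ρ => f v) hc).symm

end Irreducibility

/-! ### Converse of Schur's lemma; integrality in the group ring -/

section FiniteGroups

variable {G V : Type*} [Group G] [Fintype G] [AddCommGroup V] [Module ℂ V]

noncomputable instance : Invertible (Nat.card G : ℂ) :=
  invertibleOfNonzero (Nat.cast_ne_zero.2 Nat.card_pos.ne')

instance : NeZero (Nat.card G : ℂ) := ⟨Nat.cast_ne_zero.2 Nat.card_pos.ne'⟩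

/-- By Maschke every subrepresentation has an invariant complement. The projection along it commutes
with the action, hence is a scalar, and an idempotent scalar is 0 or 1. -/
theorem isIrreducible_of_finrank_eq_one {ρ : Representation ℂ G V}
    (h : finrank ℂ (IntertwiningMap ρ ρ) = 1) : ρ.IsIrreducible := by
  have hid : IntertwiningMap.id ρ ≠ 0 := by
    intro h0
    have : Subsingleton (IntertwiningMap ρ ρ) := by
      refine subsingleton_of_forall_eq 0 fun f => ?_
      have : f = f.comp (IntertwiningMap.id ρ) := rfl
      rw [this, h0]
      ext v
      exact map_zero f
    rw [finrank_zero_of_subsingleton] at h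
    exact zero_ne_one h
  have hscalar := (finrank_eq_one_iff_of_nonzero' (IntertwiningMap.id ρ) hid).1 h
  have hne : ∃ v : V, v ≠ 0 := by
    by_contra! hV
    exact hid (by ext v; simpa using hV v)
  have hcl : ComplementedLattice (Subrepresentation ρ) :=
    (inferInstance : IsSemisimpleRepresentation ρ)
  refine { exists_pair_ne := ⟨⊥, ⊤, fun e => ?_⟩, eq_bot_or_eq_top := fun σ => ?_ }
  · obtain ⟨v, hv⟩ := hne
    have hv' : v ∈ (⊥ : Subrepresentation ρ).toSubmodule := by rw [e]; trivial
    exact hv ((Submodule.mem_bot ℂ).1 hv')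
  · obtain ⟨τ, hτ⟩ := exists_isCompl σ
    have hc := isCompl_toSubmodule_iff.2 hτ
    let P : V →ₗ[ℂ] V := Submodule.projection _ _ hc
    have hP1 : ∀ v ∈ σ.toSubmodule, P v = v := fun v hv => by
      simpa [P] using! Submodule.projection_apply_left hc ⟨v, hv⟩
    have hP2 : ∀ v ∈ τ.toSubmodule, P v = 0 := fun v hv => by
      simpa [P] using! (Submodule.projection_apply_eq_zero_iff hc).2 hv
    obtain ⟨c, hcP⟩ := hscalar ⟨P, fun g => by
      ext v
      have hv : v ∈ σ.toSubmodule ⊔ τ.toSubmodule := by rw [hc.sup_eq_top]; trivial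
      obtain ⟨x, hx, y, hy, rfl⟩ := Submodule.mem_sup.1 hv
      simp [hP1 x hx, hP2 y hy, hP1 _ (σ.apply_mem_toSubmodule g hx),
        hP2 _ (τ.apply_mem_toSubmodule g hy)]⟩
    have hcP' : ∀ v, c • v = P v := fun v => by
      simpa using! congrArg (fun f : IntertwiningMap ρ ρ => f v) hcP
    by_cases hσ : ∃ v ∈ σ.toSubmodule, v ≠ 0
    · right
      obtain ⟨v, hv, hv0⟩ := hσ
      have hc1 : c = 1 := by
        have h1 := hcP' v
        rw [hP1 v hv] at h1
        exact smul_left_injective ℂ hv0 (by simpa using h1)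
      have hτ0 : τ = ⊥ := by
        refine Subrepresentation.toSubmodule_injective (eq_bot_iff.2 fun w hw => ?_)
        have h1 := hcP' w
        rw [hP2 w hw, hc1, one_smul] at h1
        exact h1
      simpa [hτ0] using hτ.sup_eq_top
    · left
      push Not at hσ
      exact Subrepresentation.toSubmodule_injective (eq_bot_iff.2 fun v hv => hσ v hv)

/-- A scalar operator that is a combination of the operators of a representation of a finite
group with algebraic integers as coefficients is an algebraic integer. -/
theorem isIntegral_of_sum_eq_smul [Nontrivial V] (ρ : Representation ℂ G V) (s : Finset G)
    (a : G → ℂ) (ha : ∀ g, IsIntegral ℤ (a g)) (c : ℂ)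
    (h : ∑ g ∈ s, a g • ρ g = c • LinearMap.id) : IsIntegral ℤ c := by
  let O := integralClosure ℤ ℂ
  let Φ : MonoidAlgebra O G →ₐ[O] Module.End ℂ V := MonoidAlgebra.lift O _ G ρ
  let x : MonoidAlgebra O G := ∑ g ∈ s, MonoidAlgebra.single g (⟨a g, ha g⟩ : O)
  have hx : Φ x = algebraMap ℂ (Module.End ℂ V) c := by
    rw [Module.algebraMap_end_eq_smul_id, ← h, map_sum]
    refine Finset.sum_congr rfl fun g _ => ?_
    simp only [Φ, MonoidAlgebra.lift_single]
    rfl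
  -- The group ring of a finite group over O is a finite O-module, so each of its elements is
  -- integral over O.
  have h1 : IsIntegral O (Φ x) := ((Algebra.IsIntegral.of_finite O _).isIntegral x).map Φ
  rw [hx, isIntegral_algebraMap_iff (FaithfulSMul.algebraMap_injective ℂ _)] at h1
  exact isIntegral_trans c h1

end FiniteGroups

/-! ### Character pairing and irreducible characters -/

section Characters

variable {G V W : Type*} [Group G] [Fintype G] [AddCommGroup V] [Module ℂ V]
  [FiniteDimensional ℂ V] [AddCommGroup W] [Module ℂ W] [FiniteDimensional ℂ W]

/-- The pairing `|G|⁻¹ ∑_g χ(g) ψ(g⁻¹)` of functions on `G`. -/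
noncomputable def charPairing (χ ψ : G → ℂ) : ℂ := (Nat.card G : ℂ)⁻¹ * ∑ g, χ g * ψ g⁻¹

theorem charPairing_character (ρ : Representation ℂ G V) (σ : Representation ℂ G W) :
    charPairing σ.character ρ.character = finrank ℂ (IntertwiningMap ρ σ) :=
  card_inv_mul_sum_char_mul_char_eq_finrank ρ σ

theorem charPairing_add_left (χ χ' ψ : G → ℂ) :
    charPairing (χ + χ') ψ = charPairing χ ψ + charPairing χ' ψ := by
  simp [charPairing, add_mul, Finset.sum_add_distrib, mul_add]

theorem charPairing_add_right (χ ψ ψ' : G → ℂ) :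
    charPairing χ (ψ + ψ') = charPairing χ ψ + charPairing χ ψ' := by
  simp [charPairing, Finset.sum_add_distrib, mul_add]

theorem charPairing_eq_zero {ρ : Representation ℂ G V} {σ : Representation ℂ G W}
    (hρ : ρ.IsIrreducible) (hσ : σ.IsIrreducible) (h : finrank ℂ V ≠ finrank ℂ W) :
    charPairing ρ.character σ.character = 0 := by
  have := char_orthonormal ρ σ
  rw [if_neg] at this
  · exact this
  · rintro ⟨e⟩
    exact h e.toLinearEquiv.finrank_eq.symm

theorem isIrreducible_iff_charPairing (ρ : Representation ℂ G V) :
    ρ.IsIrreducible ↔ charPairing ρ.character ρ.character = 1 := by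
  rw [charPairing_character]
  refine ⟨fun h => ?_, fun h => isIrreducible_of_finrank_eq_one (by exact_mod_cast h)⟩
  rw [IsIrreducible.finrank_intertwiningMap_self]
  simp

/-- The character alone decides irreducibility, so any representation affording it may serve as
witness; a basis moves ρ to the coordinate space that the definition requires. -/
theorem isIrreducibleCharacter_iff (ρ : Representation ℂ G V) :
    IsIrreducibleCharacter ρ.character ↔ ρ.IsIrreducible := by
  constructor
  · rintro ⟨n, σ, hσ, h⟩
    rw [isIrreducible_iff_charPairing] at hσ ⊢
    rwa [← h]
  · intro h
    let e : V ≃ₗ[ℂ] (Fin (finrank ℂ V) → ℂ) := (finBasis ℂ V).equivFun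
    let σ : Representation ℂ G (Fin (finrank ℂ V) → ℂ) :=
      { toFun := fun g => e.conj (ρ g)
        map_one' := by ext; simp
        map_mul' := fun a b => by ext; simp [LinearEquiv.conj_apply] }
    have hσ : σ.character = ρ.character := by
      ext g
      exact LinearMap.trace_conj' (ρ g) e
    refine ⟨_, σ, ?_, hσ⟩
    rw [isIrreducible_iff_charPairing] at h ⊢
    rwa [hσ]

/-- Characters take values in the algebraic integers. -/
theorem isIntegral_character (ρ : Representation ℂ G V) (g : G) : IsIntegral ℤ (ρ.character g) := by
  let b := finBasis ℂ V
  rw [Representation.character, LinearMap.trace_eq_matrix_trace ℂ b,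
    Matrix.trace_eq_sum_roots_charpoly]
  -- The trace is the sum of the eigenvalues, which are roots of unity because g has finite order.
  refine IsIntegral.multiset_sum fun μ hμ => ?_
  have h1 : Module.End.HasEigenvalue (ρ g) μ := by
    rw [Module.End.hasEigenvalue_iff_isRoot_charpoly, ← LinearMap.charpoly_toMatrix (ρ g) b]
    exact Polynomial.isRoot_of_mem_roots hμ
  obtain ⟨v, hv⟩ := h1.exists_hasEigenvector
  have h2 : μ ^ Nat.card G = 1 := by
    have h3 := hv.pow_apply (Nat.card G)
    rw [← map_pow, pow_card_eq_one', map_one] at h3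
    exact smul_left_injective ℂ hv.2 (by simpa using h3.symm)
  exact IsIntegral.of_pow Nat.card_pos (h2 ▸ isIntegral_one)

end Characters

/-! ### Characters and commutants of unitary representations -/

section UnitaryRepresentations

variable {G : Type*} [Group G] {d : ℕ}

theorem coe_map_inv (U : G →* UGroup d) (g : G) :
    (U g⁻¹ : Matrix (Fin d) (Fin d) ℂ) = (U g : Matrix (Fin d) (Fin d) ℂ)ᴴ := by
  rw [map_inv]
  rfl

theorem character_rep (U : G →* UGroup d) (g : G) :
    (rep U).character g = Matrix.trace (U g : Matrix (Fin d) (Fin d) ℂ) :=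
  Matrix.trace_toLin'_eq _

theorem character_rep_inv (U : G →* UGroup d) (g : G) :
    (rep U).character g⁻¹ = conj ((rep U).character g) := by
  rw [character_rep, character_rep, coe_map_inv, Matrix.trace_conjTranspose]
  rfl

theorem character_rep2 (U : G →* UGroup d) (g : G) :
    (rep2 U).character g = (rep U).character g ^ 2 := by
  rw [rep2, char_tensor, Pi.mul_apply, sq]

theorem character_rep2_inv (U : G →* UGroup d) (g : G) :
    (rep2 U).character g⁻¹ = conj ((rep2 U).character g) := by
  rw [character_rep2, character_rep2, character_rep_inv, map_pow]

theorem charInner_rep2 [Fintype G] (U : G →* UGroup d) :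
    charInner (rep2 U).character (rep2 U).character =
      charPairing (rep2 U).character (rep2 U).character := by
  simp only [charInner, charPairing, character_rep2_inv, Fintype.card_eq_nat_card, mul_comm]

theorem exists_eq_smul_one_of_commute {U : G →* UGroup d} (h : (rep U).IsIrreducible)
    (A : Matrix (Fin d) (Fin d) ℂ) (hA : ∀ g, A * U g = U g * A) : ∃ c : ℂ, A = c • 1 := by
  obtain ⟨c, hc⟩ := exists_eq_smul_id_of_commute h (Matrix.toLin' A) fun g => by
    change _ ∘ₗ Matrix.toLin' _ = Matrix.toLin' _ ∘ₗ _
    rw [← Matrix.toLin'_mul, ← Matrix.toLin'_mul, hA]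
  refine ⟨c, Matrix.toLin'.injective ?_⟩
  rw [hc, map_smul, Matrix.toLin'_one]

theorem norm_eq_one_of_coe_eq_smul_one (hd : 1 ≤ d) {x : UGroup d} {c : ℂ}
    (h : (x : Matrix (Fin d) (Fin d) ℂ) = c • 1) : ‖c‖ = 1 := by
  have h1 := Matrix.mem_unitaryGroup_iff.1 x.2
  have h2 := congrFun (congrFun h1 ⟨0, hd⟩) ⟨0, hd⟩
  rw [h] at h2
  simp only [star_smul, star_one, Algebra.mul_smul_comm, mul_one, Matrix.smul_apply,
    Matrix.one_apply_eq, smul_eq_mul, RCLike.star_def] at h2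
  rw [Complex.conj_mul'] at h2
  exact (pow_eq_one_iff_of_nonneg (norm_nonneg c) two_ne_zero).1 (by exact_mod_cast h2)

theorem exists_coe_eq_smul_one_of_mem_repCenter (hd : 1 ≤ d) {U : G →* UGroup d}
    (h : (rep U).IsIrreducible) {z : UGroup d} (hz : z ∈ repCenter U) :
    ∃ c : ℂ, ‖c‖ = 1 ∧ (z : Matrix (Fin d) (Fin d) ℂ) = c • 1 := by
  obtain ⟨c, hc⟩ := exists_eq_smul_one_of_commute h z fun g => congrArg Subtype.val (hz.2 g)
  exact ⟨c, norm_eq_one_of_coe_eq_smul_one hd hc, hc⟩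

/-- A unitary representation whose commutant consists of scalars is irreducible. -/
theorem isIrreducible_rep_of_commutant [Fintype G] (hd : 1 ≤ d) {U : G →* UGroup d}
    (h : ∀ A : Matrix (Fin d) (Fin d) ℂ, (∀ g, A * U g = U g * A) → ∃ c : ℂ, A = c • 1) :
    (rep U).IsIrreducible := by
  refine isIrreducible_of_finrank_eq_one
    ((finrank_eq_one_iff_of_nonzero' (IntertwiningMap.id (rep U)) ?_).2 fun f => ?_)
  · intro h0
    have := congrArg (fun f : IntertwiningMap (rep U) (rep U) => f (fun _ => 1) ⟨0, hd⟩) h0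
    simp at this
  · obtain ⟨c, hc⟩ := h (LinearMap.toMatrix' f.toLinearMap) fun g => by
      have := f.isIntertwining' g
      apply Matrix.toLin'.injective
      rw [Matrix.toLin'_mul, Matrix.toLin'_mul, Matrix.toLin'_toMatrix']
      exact this
    refine ⟨c, IntertwiningMap.ext ?_⟩
    have := congrArg Matrix.toLin' hc
    rw [Matrix.toLin'_toMatrix', map_smul, Matrix.toLin'_one] at this
    rw [this]
    rfl

end UnitaryRepresentations

/-! ### Averages over transversals; divisibility by dimensions -/

section Transversals

variable {G : Type*} [Group G] {d : ℕ}

/-- `D` consists of exactly one element `U g` for each coset `g N`. -/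
structure IsCosetTransversal (D : Finset (UGroup d)) (U : G →* UGroup d) (N : Subgroup G) :
    Prop where
  ker_le : U.ker ≤ N
  mem_range : ∀ x ∈ D, x ∈ Set.range U
  existsUnique : ∀ g, ∃! x, x ∈ D ∧ ∃ n ∈ N, x = U (g * n)

/-- Taking N to be the kernel lets the matrix group and the group designs share the same counting
arguments. -/
theorem isCosetTransversal_matrixGroup [Finite G] (U : G →* UGroup d) :
    IsCosetTransversal (matrixGroup U) U U.ker where
  ker_le := le_rfl
  mem_range := fun x hx => by simpa [matrixGroup] using hx
  existsUnique := fun g => by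
    refine ⟨U g, ⟨by simp [matrixGroup], 1, one_mem _, by simp⟩, ?_⟩
    rintro x ⟨-, n, hn, rfl⟩
    rw [map_mul, MonoidHom.mem_ker.1 hn, mul_one]

/-- The elements of `G` whose matrices lie in the center `Z(U)`. -/
def centerPreimage (U : G →* UGroup d) : Subgroup G := (Subgroup.centralizer (Set.range U)).comap U

theorem mem_centerPreimage {U : G →* UGroup d} {n : G} :
    n ∈ centerPreimage U ↔ U n ∈ repCenter U := by
  simp [centerPreimage, repCenter, Subgroup.mem_centralizer_iff, eq_comm]

theorem IsInducedBy.isCosetTransversal {D : Finset (UGroup d)} {U : G →* UGroup d}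
    (h : IsInducedBy D U) : IsCosetTransversal D U (centerPreimage U) where
  ker_le := fun n hn => by
    rw [mem_centerPreimage, MonoidHom.mem_ker.1 hn]
    exact ⟨⟨1, map_one U⟩, fun _ => by simp⟩
  mem_range := h.1
  existsUnique := fun g => by
    have : ∀ x, (x ∈ D ∧ ∃ n ∈ centerPreimage U, x = U (g * n)) ↔
        (x ∈ D ∧ ∃ z ∈ repCenter U, x = U g * z) := fun x => by
      refine and_congr_right fun _ => ⟨?_, ?_⟩
      · rintro ⟨n, hn, rfl⟩
        exact ⟨U n, mem_centerPreimage.1 hn, map_mul _ _ _⟩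
      · rintro ⟨z, hz, rfl⟩
        obtain ⟨n, rfl⟩ := hz.1
        exact ⟨n, mem_centerPreimage.2 hz, (map_mul _ _ _).symm⟩
    simp only [this]
    exact h.2 g

namespace IsCosetTransversal

variable {D : Finset (UGroup d)} {U : G →* UGroup d} {N : Subgroup G}

theorem nonempty (h : IsCosetTransversal D U N) : D.Nonempty :=
  let ⟨x, hx, _⟩ := h.existsUnique 1
  ⟨x, hx.1⟩

/-- The map (x, n) ↦ s(x)n is a bijection from D × N to G; surjectivity needs ker U ≤ N, as s(x) is
determined only up to the kernel. The summand lives on G because the divisibility proof sums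
operators of a representation other than U. -/
theorem sum_eq [Fintype G] (h : IsCosetTransversal D U N) {M : Type*} [AddCommMonoid M]
    {s : UGroup d → G} (hs : ∀ x ∈ D, U (s x) = x) (f : G → M)
    (hf : ∀ g, ∀ n ∈ N, f (g * n) = f g) :
    ∑ g, f g = Nat.card N • ∑ x ∈ D, f (s x) := by
  classical
  have h1 : ∀ x ∈ D, ∑ n : N, f (s x * n) = Nat.card N • f (s x) := fun x _ => by
    rw [Finset.sum_congr rfl fun n _ => hf _ _ n.2]
    simp
  rw [Finset.smul_sum, ← Finset.sum_congr rfl h1, ← Finset.sum_product']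
  symm
  refine Finset.sum_bij (fun p _ => s p.1 * p.2) (fun _ _ => Finset.mem_univ _) ?_ ?_
    (fun _ _ => rfl)
  · rintro ⟨x, n⟩ hx ⟨y, m⟩ hy hxy
    simp only [Finset.mem_product, Finset.mem_univ, and_true] at hx hy hxy
    obtain rfl : x = y := (h.existsUnique (s x * n)).unique
      ⟨hx, (n : G)⁻¹, inv_mem n.2, by simp [hs x hx]⟩
      ⟨hy, (m : G)⁻¹, inv_mem m.2, by rw [hxy]; simp [hs y hy]⟩
    rw [mul_right_inj] at hxy
    rw [Subtype.ext hxy]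
  · intro g _
    obtain ⟨x, ⟨hx, n, hn, hxn⟩, -⟩ := h.existsUnique g
    have hmem : (s x)⁻¹ * g ∈ N := by
      have : (s x)⁻¹ * (g * n) ∈ N := h.ker_le (by
        rw [MonoidHom.mem_ker, map_mul, ← hxn, map_inv, hs x hx, inv_mul_cancel])
      simpa [mul_assoc] using N.mul_mem this (inv_mem hn)
    exact ⟨(x, ⟨_, hmem⟩), by simpa using hx, by simp⟩

theorem exists_section (h : IsCosetTransversal D U N) : ∃ s : UGroup d → G,
    ∀ x ∈ D, U (s x) = x := by
  classical
  have : ∀ x, ∃ g, x ∈ D → U g = x := fun x => by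
    by_cases hx : x ∈ D
    · obtain ⟨g, hg⟩ := h.mem_range x hx
      exact ⟨g, fun _ => hg⟩
    · exact ⟨1, fun h => absurd h hx⟩
  choose s hs using this
  exact ⟨s, hs⟩

theorem sum_comp_eq [Fintype G] (h : IsCosetTransversal D U N) {M : Type*} [AddCommMonoid M]
    (f : UGroup d → M) (hf : ∀ x, ∀ n ∈ N, f (x * U n) = f x) :
    ∑ g, f (U g) = Nat.card N • ∑ x ∈ D, f x := by
  obtain ⟨s, hs⟩ := h.exists_section
  rw [h.sum_eq hs (fun g => f (U g)) fun g n hn => by rw [map_mul, hf _ _ hn],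
    Finset.sum_congr rfl fun x hx => by rw [hs x hx]]

theorem card_eq [Fintype G] (h : IsCosetTransversal D U N) :
    Nat.card G = Nat.card N * D.card := by
  have h1 := h.sum_comp_eq (fun _ => 1) fun _ _ _ => rfl
  rw [Nat.card_eq_fintype_card (α := G)]
  simpa only [Finset.sum_const, smul_eq_mul, mul_one, Finset.card_univ] using h1

/-- The average over the group is the average over a transversal. -/
theorem average_eq [Fintype G] (h : IsCosetTransversal D U N)
    (f : UGroup d → ℂ) (hf : ∀ x, ∀ n ∈ N, f (x * U n) = f x) :
    (Nat.card G : ℂ)⁻¹ * ∑ g, f (U g) = (D.card : ℂ)⁻¹ * ∑ x ∈ D, f x := by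
  rw [h.sum_comp_eq f hf, h.card_eq, nsmul_eq_mul]
  have : (Nat.card N : ℂ) ≠ 0 := Nat.cast_ne_zero.2 Nat.card_pos.ne'
  push_cast
  field_simp

/-- The dimension of an irreducible representation divides the index of a subgroup that acts by
scalars. -/
theorem finrank_dvd_card [Fintype G] (h : IsCosetTransversal D U N) {V : Type*} [AddCommGroup V]
    [Module ℂ V] [FiniteDimensional ℂ V] {ρ : Representation ℂ G V} (hρ : ρ.IsIrreducible)
    (hN : ∀ n ∈ N, ∃ c : ℂ, ρ n = c • LinearMap.id) : finrank ℂ V ∣ D.card := by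
  have hnt : Nontrivial V := by
    by_contra hV
    rw [not_nontrivial_iff_subsingleton] at hV
    exact bot_ne_top (Subrepresentation.toSubmodule_injective
      (Subsingleton.elim (⊥ : Submodule ℂ V) ⊤) : (⊥ : Subrepresentation ρ) = ⊤)
  have hn0 : (finrank ℂ V : ℂ) ≠ 0 := Nat.cast_ne_zero.2 finrank_pos.ne'
  have hG0 : (Nat.card G : ℂ) ≠ 0 := Nat.cast_ne_zero.2 Nat.card_pos.ne'
  have hN0 : (Nat.card N : ℂ) ≠ 0 := Nat.cast_ne_zero.2 Nat.card_pos.ne'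
  obtain ⟨s, hs⟩ := h.exists_section
  -- The factor χ(g⁻¹) cancels the scalar by which N acts, so f is constant on cosets of N.
  let f : G → Module.End ℂ V := fun g => ρ.character g⁻¹ • ρ g
  have hf : ∀ g, ∀ n ∈ N, f (g * n) = f g := fun g n hn => by
    obtain ⟨c, hc⟩ := hN n hn
    obtain ⟨c', hc'⟩ := hN n⁻¹ (inv_mem hn)
    have hcc : c' * c = 1 := by
      have h1 : ρ n⁻¹ * ρ n = 1 := by rw [← map_mul, inv_mul_cancel, map_one]
      obtain ⟨v, hv⟩ := exists_ne (0 : V)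
      have h2 := LinearMap.congr_fun h1 v
      rw [hc, hc'] at h2
      refine smul_left_injective ℂ hv ?_
      simpa [smul_smul, mul_comm] using h2
    have h1 : ρ.character (g * n)⁻¹ = c' * ρ.character g⁻¹ := by
      have : ρ (g * n)⁻¹ = c' • ρ g⁻¹ := by
        rw [mul_inv_rev, map_mul, hc']
        ext; simp
      rw [character, this, map_smul]
      rfl
    have h2 : ρ (g * n) = c • ρ g := by
      rw [map_mul, hc]
      ext; simp
    simp only [f]
    rw [h1, h2, smul_smul, mul_right_comm, hcc, one_mul]
  -- Characters are class functions, so the sum commutes with the action and is a scalar. Its trace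
  -- is |G|⟨χ, χ⟩ = |G|, which determines c.
  obtain ⟨c, hc⟩ := exists_eq_smul_id_of_commute hρ (∑ g, f g) fun g => by
    change (∑ x, f x) * ρ g = ρ g * ∑ x, f x
    rw [Finset.sum_mul, Finset.mul_sum]
    refine Fintype.sum_equiv ((MulAut.conj g⁻¹).toEquiv) _ _ fun x => ?_
    have : ρ.character (g⁻¹ * x * g)⁻¹ = ρ.character x⁻¹ := by
      rw [show (g⁻¹ * x * g)⁻¹ = g⁻¹ * x⁻¹ * g⁻¹⁻¹ by group, char_conj]
    change (ρ.character x⁻¹ • ρ x) * ρ g =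
      ρ g * (ρ.character (g⁻¹ * x * g⁻¹⁻¹)⁻¹ • ρ (g⁻¹ * x * g⁻¹⁻¹))
    rw [inv_inv, this, smul_mul_assoc, mul_smul_comm, ← map_mul, ← map_mul]
    congr 2
    group
  have htr : c * finrank ℂ V = Nat.card G := by
    have h1 := congrArg (LinearMap.trace ℂ V) hc
    have h2 := (isIrreducible_iff_charPairing ρ).1 hρ
    rw [charPairing, inv_mul_eq_one₀ hG0] at h2
    rw [map_smul, LinearMap.trace_id, smul_eq_mul, map_sum] at h1
    rw [← h1, h2]
    refine Finset.sum_congr rfl fun g _ => ?_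
    simp only [f, map_smul, smul_eq_mul]
    exact mul_comm _ _
  rw [h.sum_eq hs f hf] at hc
  have hsum : ∑ x ∈ D, f (s x) = ((D.card : ℂ) / finrank ℂ V) • LinearMap.id := by
    have h1 : (Nat.card N : ℂ) • ∑ x ∈ D, f (s x) = c • LinearMap.id := by
      rw [← hc, Nat.cast_smul_eq_nsmul]
    rw [h.card_eq] at htr
    push_cast at htr
    have h2 : (D.card : ℂ) / finrank ℂ V = (Nat.card N : ℂ)⁻¹ * c := by
      field_simp
      rw [mul_comm, ← htr, mul_comm]
    rw [h2, ← smul_smul, ← h1, smul_smul, inv_mul_cancel₀ hN0, one_smul]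
  -- Summing over D instead of G removes the factor |N| and leaves the scalar |D| / dim V, which is
  -- an algebraic integer and rational, hence an integer.
  have hint : IsIntegral ℤ ((D.card : ℂ) / finrank ℂ V) := by
    classical
    have hinj : Set.InjOn s D := fun x hx y hy hxy => by
      rw [← hs x hx, ← hs y hy, hxy]
    refine isIntegral_of_sum_eq_smul ρ (D.image s) (fun g => ρ.character g⁻¹)
      (fun g => isIntegral_character ρ _) _ ?_
    rw [Finset.sum_image hinj]
    exact hsum
  have hint' : IsIntegral ℤ ((D.card : ℚ) / finrank ℂ V) := by
    rw [← isIntegral_algebraMap_iff (B := ℂ) (algebraMap ℚ ℂ).injective]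
    simpa using hint
  obtain ⟨m, hm⟩ := IsIntegrallyClosed.isIntegral_iff.1 hint'
  have hm' : (D.card : ℤ) = finrank ℂ V * m := by
    have : (finrank ℂ V : ℚ) ≠ 0 := Nat.cast_ne_zero.2 finrank_pos.ne'
    rw [eq_div_iff this] at hm
    rw [mul_comm]
    have hm2 : (m : ℚ) * finrank ℂ V = D.card := by simpa using hm
    exact_mod_cast hm2.symm
  exact Int.natCast_dvd_natCast.1 ⟨m, hm'⟩

end IsCosetTransversal

end Transversals

/-! ### Positivity, monotonicity and character formula of the frame potential -/

section FramePotential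

variable {d : ℕ}

/-- The kernel `|tr (x† y)|⁴` of the frame potential. -/
noncomputable def frameKernel (x y : UGroup d) : ℝ :=
  ‖Matrix.trace ((x : Matrix (Fin d) (Fin d) ℂ)ᴴ * (y : Matrix (Fin d) (Fin d) ℂ))‖ ^ 4

theorem frameKernel_mul_left (z x y : UGroup d) :
    frameKernel (z * x) (z * y) = frameKernel x y := by
  have h1 : (z : Matrix (Fin d) (Fin d) ℂ)ᴴ * z = 1 := Matrix.mem_unitaryGroup_iff'.1 z.2
  have h2 : ((z * x : UGroup d) : Matrix (Fin d) (Fin d) ℂ)ᴴ * (z * y : UGroup d) =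
      (x : Matrix (Fin d) (Fin d) ℂ)ᴴ * y := by
    change (z.1 * x.1)ᴴ * (z.1 * y.1) = _
    rw [Matrix.conjTranspose_mul, mul_assoc, ← mul_assoc _ z.1, h1, one_mul]
  rw [frameKernel, h2, frameKernel]

theorem frameKernel_comm (x y : UGroup d) : frameKernel x y = frameKernel y x := by
  rw [frameKernel, frameKernel, ← norm_star, ← Matrix.trace_conjTranspose,
    Matrix.conjTranspose_mul, Matrix.conjTranspose_conjTranspose]

theorem frameKernel_mul_smul {x z : UGroup d} (y : UGroup d) {c : ℂ} (hc : ‖c‖ = 1)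
    (hz : (z : Matrix (Fin d) (Fin d) ℂ) = c • 1) : frameKernel y (x * z) = frameKernel y x := by
  have : ((x * z : UGroup d) : Matrix (Fin d) (Fin d) ℂ) = c • x.1 := by
    change x.1 * z.1 = _
    rw [hz, mul_smul_comm, mul_one]
  rw [frameKernel, frameKernel, this, mul_smul_comm, Matrix.trace_smul, norm_smul, hc, one_mul]

theorem sum_mul_sum_mul_sum_mul_sum {α : Type*} [Fintype α] (f₁ f₂ f₃ f₄ : α → ℂ) :
    (∑ i, f₁ i) * ((∑ i, f₂ i) * ((∑ i, f₃ i) * ∑ i, f₄ i)) =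
      ∑ p : α × α × α × α, f₁ p.1 * (f₂ p.2.1 * (f₃ p.2.2.1 * f₄ p.2.2.2)) := by
  simp_rw [Fintype.sum_prod_type, ← Finset.mul_sum, ← Finset.sum_mul]

/-- The frame kernel is positive semidefinite. -/
theorem sum_mul_frameKernel_nonneg (T : Finset (UGroup d)) (a : UGroup d → ℝ) :
    0 ≤ ∑ x ∈ T, ∑ y ∈ T, a x * a y * frameKernel x y := by
  let ι := Fin d × Fin d
  -- The entries of x ⊗ x ⊗ x̄ ⊗ x̄: the kernel is the Gram matrix of these vectors.
  let v : ι × ι × ι × ι → UGroup d → ℂ := fun p x =>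
    (x : Matrix (Fin d) (Fin d) ℂ) p.1.1 p.1.2 *
      (x : Matrix (Fin d) (Fin d) ℂ) p.2.1.1 p.2.1.2 *
      (conj ((x : Matrix (Fin d) (Fin d) ℂ) p.2.2.1.1 p.2.2.1.2) *
      conj ((x : Matrix (Fin d) (Fin d) ℂ) p.2.2.2.1 p.2.2.2.2))
  have hk : ∀ x y : UGroup d, (frameKernel x y : ℂ) = ∑ p, conj (v p x) * v p y := by
    intro x y
    set t := Matrix.trace ((x : Matrix (Fin d) (Fin d) ℂ)ᴴ * (y : Matrix (Fin d) (Fin d) ℂ)) with ht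
    have ht' : t = ∑ q : ι, conj ((x : Matrix (Fin d) (Fin d) ℂ) q.1 q.2) *
        (y : Matrix (Fin d) (Fin d) ℂ) q.1 q.2 := by
      rw [ht, Fintype.sum_prod_type, Finset.sum_comm]
      rfl
    have htc : conj t = ∑ q : ι, (x : Matrix (Fin d) (Fin d) ℂ) q.1 q.2 *
        conj ((y : Matrix (Fin d) (Fin d) ℂ) q.1 q.2) := by
      rw [ht', map_sum]
      simp
    have h1 : (frameKernel x y : ℂ) = t * (t * (conj t * conj t)) := by
      have : t * (t * (conj t * conj t)) = (conj t * t) ^ 2 := by ring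
      rw [this, Complex.conj_mul', frameKernel, ← ht]
      push_cast
      ring
    rw [h1]
    nth_rewrite 1 2 [ht']
    rw [htc]
    rw [sum_mul_sum_mul_sum_mul_sum]
    refine Finset.sum_congr rfl fun p _ => ?_
    simp only [v, map_mul, Complex.conj_conj]
    ring
  clear_value v
  have h : ((∑ x ∈ T, ∑ y ∈ T, a x * a y * frameKernel x y : ℝ) : ℂ) =
      ((∑ p, ‖∑ x ∈ T, (a x : ℂ) * v p x‖ ^ 2 : ℝ) : ℂ) := by
    push_cast
    simp_rw [← Complex.conj_mul', hk, map_sum, Finset.sum_mul_sum, Finset.mul_sum]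
    rw [Finset.sum_comm (s := Finset.univ)]
    refine Finset.sum_congr rfl fun x _ => ?_
    rw [Finset.sum_comm]
    refine Finset.sum_congr rfl fun p _ => Finset.sum_congr rfl fun y _ => ?_
    rw [map_mul, Complex.conj_ofReal]
    ring
  rw [Complex.ofReal_inj.1 h]
  positivity

theorem framePotential_eq (D : Finset (UGroup d)) :
    framePotential D = (∑ x ∈ D, ∑ y ∈ D, frameKernel x y) / (D.card : ℝ) ^ 2 := rfl

variable {G : Type*} [Group G]

/-- The matrix group minimizes the frame potential among its non-empty subsets. -/
theorem framePotential_matrixGroup_le [Finite G] (U : G →* UGroup d) {D : Finset (UGroup d)}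
    (hne : D.Nonempty) (hD : ∀ x ∈ D, x ∈ Set.range U) :
    framePotential (matrixGroup U) ≤ framePotential D := by
  classical
  set M := matrixGroup U with hM
  have hmem : ∀ x, x ∈ M ↔ x ∈ Set.range U := fun x => by simp [hM, matrixGroup]
  have hDM : D ⊆ M := fun x hx => (hmem x).2 (hD x hx)
  have hD0 : (D.card : ℝ) ≠ 0 := Nat.cast_ne_zero.2 (Finset.card_pos.2 hne).ne'
  have hM0 : (M.card : ℝ) ≠ 0 := Nat.cast_ne_zero.2 (Finset.card_pos.2 (hne.mono hDM)).ne'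
  set κ := ∑ y ∈ M, frameKernel 1 y with hκ
  have hrow : ∀ x ∈ M, ∑ y ∈ M, frameKernel x y = κ := by
    intro x hx
    obtain ⟨g, rfl⟩ := (hmem x).1 hx
    refine Finset.sum_nbij' (fun y => (U g)⁻¹ * y) (fun y => U g * y) ?_ ?_ ?_ ?_ ?_
    · intro y hy
      obtain ⟨h, rfl⟩ := (hmem y).1 hy
      exact (hmem _).2 ⟨g⁻¹ * h, by simp⟩
    · intro y hy
      obtain ⟨h, rfl⟩ := (hmem y).1 hy
      exact (hmem _).2 ⟨g * h, by simp⟩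
    · intro y _; simp
    · intro y _; simp
    · intro y _
      rw [← frameKernel_mul_left (U g)⁻¹, inv_mul_cancel]
  let a : UGroup d → ℝ := fun x => (if x ∈ D then (D.card : ℝ)⁻¹ else 0)
  have hsumD : ∀ f : UGroup d → ℝ, ∑ x ∈ M, a x * f x = (D.card : ℝ)⁻¹ * ∑ x ∈ D, f x := by
    intro f
    simp only [a, ite_mul, zero_mul]
    rw [Finset.sum_ite_mem, Finset.inter_eq_right.2 hDM, Finset.mul_sum]
  -- Positivity is tested on the uniform weight of D minus the uniform weight of M.
  have h0 := sum_mul_frameKernel_nonneg M fun x => a x - (M.card : ℝ)⁻¹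
  have hP : framePotential D = ∑ x ∈ M, a x * ∑ y ∈ M, a y * frameKernel x y := by
    simp_rw [hsumD]
    rw [framePotential_eq, ← Finset.mul_sum]
    field_simp
  have hPM : framePotential M = (M.card : ℝ)⁻¹ * κ := by
    rw [framePotential_eq, Finset.sum_congr rfl hrow, Finset.sum_const, nsmul_eq_mul]
    field_simp
  have hc1 : ∑ x ∈ M, a x * ∑ y ∈ M, frameKernel x y = κ := by
    rw [Finset.sum_congr rfl fun x hx => by rw [hrow x hx], hsumD, Finset.sum_const, nsmul_eq_mul]
    field_simp
  have hc2 : ∑ x ∈ M, ∑ y ∈ M, a y * frameKernel x y = κ := by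
    rw [Finset.sum_comm, ← hc1]
    simp_rw [Finset.mul_sum, frameKernel_comm]
  have hc3 : ∑ x ∈ M, ∑ y ∈ M, frameKernel x y = M.card * κ := by
    rw [Finset.sum_congr rfl hrow, Finset.sum_const, nsmul_eq_mul]
  -- Because row sums are constant, each cross term equals the potential of M, so the energy of the
  -- difference is that of D minus that of M.
  have hexp : ∑ x ∈ M, ∑ y ∈ M, (a x - (M.card : ℝ)⁻¹) * (a y - (M.card : ℝ)⁻¹) * frameKernel x y
      = framePotential D - (M.card : ℝ)⁻¹ * κ - (M.card : ℝ)⁻¹ * κ +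
        (M.card : ℝ)⁻¹ * (M.card : ℝ)⁻¹ * (M.card * κ) := by
    rw [hP, ← hc3]
    nth_rewrite 1 [← hc1]
    rw [← hc2]
    simp only [Finset.mul_sum, ← Finset.sum_sub_distrib, ← Finset.sum_add_distrib]
    refine Finset.sum_congr rfl fun x _ => Finset.sum_congr rfl fun y _ => ?_
    ring
  rw [hexp] at h0
  rw [hPM]
  have : (M.card : ℝ)⁻¹ * (M.card : ℝ)⁻¹ * (M.card * κ) = (M.card : ℝ)⁻¹ * κ := by field_simp
  linarith

theorem frameKernel_map (U : G →* UGroup d) (g h : G) :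
    (frameKernel (U g) (U h) : ℂ) =
      (rep2 U).character (g⁻¹ * h) * (rep2 U).character (g⁻¹ * h)⁻¹ := by
  rw [character_rep2_inv, character_rep2, character_rep, map_mul, Complex.mul_conj',
    frameKernel]
  have : ((U g⁻¹ * U h : UGroup d) : Matrix (Fin d) (Fin d) ℂ) =
    (U g : Matrix (Fin d) (Fin d) ℂ)ᴴ * U h := by
      rw [← coe_map_inv]
      rfl
  rw [this, norm_pow]
  push_cast
  ring

/-- The frame potential of a transversal modulo scalars is `‖ζ‖²` for the character `ζ` of the
tensor square. -/
theorem IsCosetTransversal.framePotential_eq [Fintype G] {D : Finset (UGroup d)}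
    {U : G →* UGroup d} {N : Subgroup G} (h : IsCosetTransversal D U N)
    (hN : ∀ n ∈ N, ∃ c : ℂ, ‖c‖ = 1 ∧ (U n : Matrix (Fin d) (Fin d) ℂ) = c • 1) :
    (framePotential D : ℂ) = charPairing (rep2 U).character (rep2 U).character := by
  have hinv : ∀ y x, ∀ n ∈ N, frameKernel y (x * U n) = frameKernel y x := fun y x n hn => by
    obtain ⟨c, hc, hn⟩ := hN n hn
    exact frameKernel_mul_smul y hc hn
  have h1 : (framePotential D : ℂ) =
      (D.card : ℂ)⁻¹ * ∑ x ∈ D, (D.card : ℂ)⁻¹ * ∑ y ∈ D, (frameKernel x y : ℂ) := by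
    rw [GroupDesign.framePotential_eq, ← Finset.mul_sum]
    push_cast
    rw [← mul_assoc, ← mul_inv, ← sq, div_eq_inv_mul]
  rw [h1]
  have h2 : ∀ x, (D.card : ℂ)⁻¹ * ∑ y ∈ D, (frameKernel x y : ℂ) =
      (Nat.card G : ℂ)⁻¹ * ∑ k, (frameKernel x (U k) : ℂ) := fun x =>
    (h.average_eq _ fun y n hn => by rw [hinv x y n hn]).symm
  simp_rw [h2]
  rw [← h.average_eq (fun x => (Nat.card G : ℂ)⁻¹ * ∑ k, (frameKernel x (U k) : ℂ))
    fun x n hn => by simp_rw [frameKernel_comm _ (U _), hinv _ x n hn]]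
  have h3 : ∀ g, ∑ k, (frameKernel (U g) (U k) : ℂ) =
      ∑ k, (rep2 U).character k * (rep2 U).character k⁻¹ := fun g => by
    simp_rw [frameKernel_map]
    exact Fintype.sum_equiv (Equiv.mulLeft g⁻¹) _ _ fun _ => rfl
  simp_rw [h3, charPairing]
  rw [Finset.sum_const, Finset.card_univ, ← Nat.card_eq_fintype_card, nsmul_eq_mul, ← mul_assoc,
    inv_mul_cancel₀ (Nat.cast_ne_zero.2 Nat.card_pos.ne'), one_mul]

theorem framePotential_matrixGroup [Fintype G] (U : G →* UGroup d) :
    (framePotential (matrixGroup U) : ℂ) =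
      charPairing (rep2 U).character (rep2 U).character :=
  (isCosetTransversal_matrixGroup U).framePotential_eq fun n hn =>
    ⟨1, norm_one, by rw [MonoidHom.mem_ker.1 hn, one_smul]; rfl⟩

theorem IsInducedBy.framePotential_eq [Fintype G] (hd : 1 ≤ d) {D : Finset (UGroup d)}
    {U : G →* UGroup d} (h : IsInducedBy D U) (hU : (rep U).IsIrreducible) :
    (framePotential D : ℂ) = charPairing (rep2 U).character (rep2 U).character :=
  h.isCosetTransversal.framePotential_eq fun _ hn =>
    exists_coe_eq_smul_one_of_mem_repCenter hd hU (mem_centerPreimage.1 hn)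

end FramePotential

/-! ### The flip and Schur-Weyl duality -/

section Swap

variable {d : ℕ}

/-- The matrix of the flip `x ⊗ y ↦ y ⊗ x`. -/
def swapMatrix (d : ℕ) : Matrix (Fin d × Fin d) (Fin d × Fin d) ℂ :=
  (1 : Matrix (Fin d × Fin d) (Fin d × Fin d) ℂ).submatrix Prod.swap id

theorem swapMatrix_apply (p q : Fin d × Fin d) :
    swapMatrix d p q = if p.swap = q then 1 else 0 := by
  simp [swapMatrix, Matrix.one_apply]

theorem swapMatrix_mul (X : Matrix (Fin d × Fin d) (Fin d × Fin d) ℂ) (p q : Fin d × Fin d) :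
    (swapMatrix d * X) p q = X p.swap q := by
  simp [Matrix.mul_apply, swapMatrix_apply]

theorem mul_swapMatrix (X : Matrix (Fin d × Fin d) (Fin d × Fin d) ℂ) (p q : Fin d × Fin d) :
    (X * swapMatrix d) p q = X p q.swap := by
  simp [Matrix.mul_apply, swapMatrix_apply, Prod.swap_eq_iff_eq_swap]

theorem tensorSq_apply (V : UGroup d) (p q : Fin d × Fin d) :
    tensorSq V p q =
      (V : Matrix (Fin d) (Fin d) ℂ) p.1 q.1 * (V : Matrix (Fin d) (Fin d) ℂ) p.2 q.2 :=
  rfl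

theorem tensorSq_mul_swapMatrix (V : UGroup d) :
    tensorSq V * swapMatrix d = swapMatrix d * tensorSq V := by
  ext p q
  rw [mul_swapMatrix, swapMatrix_mul, tensorSq_apply, tensorSq_apply, mul_comm]
  rfl

theorem tensorSq_mul (V W : UGroup d) : tensorSq (V * W) = tensorSq V * tensorSq W :=
  Matrix.mul_kronecker_mul _ _ _ _

theorem tensorSq_conjTranspose_mul (V : UGroup d) : (tensorSq V)ᴴ * tensorSq V = 1 := by
  have h : (V : Matrix (Fin d) (Fin d) ℂ)ᴴ * V = 1 := Matrix.mem_unitaryGroup_iff'.1 V.2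
  rw [tensorSq, Matrix.conjTranspose_kronecker, ← Matrix.mul_kronecker_mul, h,
    Matrix.one_kronecker_one]

theorem tensorSq_mul_conjTranspose (V : UGroup d) : tensorSq V * (tensorSq V)ᴴ = 1 := by
  have h : (V : Matrix (Fin d) (Fin d) ℂ) * (V : Matrix (Fin d) (Fin d) ℂ)ᴴ = 1 :=
    Matrix.mem_unitaryGroup_iff.1 V.2
  rw [tensorSq, Matrix.conjTranspose_kronecker, ← Matrix.mul_kronecker_mul, h,
    Matrix.one_kronecker_one]

theorem tensorSq_mul_mul_conjTranspose_eq_iff (V : UGroup d)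
    (X : Matrix (Fin d × Fin d) (Fin d × Fin d) ℂ) :
    tensorSq V * X * (tensorSq V)ᴴ = X ↔ tensorSq V * X = X * tensorSq V := by
  constructor
  · intro h
    nth_rewrite 2 [← h]
    rw [mul_assoc _ _ (tensorSq V), tensorSq_conjTranspose_mul, mul_one]
  · intro h
    rw [h, mul_assoc, tensorSq_mul_conjTranspose, mul_one]

/-- A matrix on `ℂ^d ⊗ ℂ^d` that commutes with `V ⊗ V` for diagonal `V` preserves the multisets of
tensor indices. -/
theorem apply_eq_zero_of_commute_diagonal {X : Matrix (Fin d × Fin d) (Fin d × Fin d) ℂ}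
    (hX : ∀ V : UGroup d, tensorSq V * X = X * tensorSq V) {p q : Fin d × Fin d}
    (h1 : p ≠ q) (h2 : p ≠ q.swap) : X p q = 0 := by
  -- Test with the diagonal unitary having the entry i at a and 1 elsewhere. Its eigenvalue at an
  -- index pair is i raised to the multiplicity of a; as 1, i, -1 are distinct, X respects
  -- multiplicities.
  have key : ∀ a : Fin d, X p q = 0 ∨
      (if p.1 = a then Complex.I else 1) * (if p.2 = a then Complex.I else 1) =
        (if q.1 = a then Complex.I else 1) * (if q.2 = a then Complex.I else 1) := by
    intro a
    let t : Fin d → ℂ := fun m => if m = a then Complex.I else 1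
    have ht : Matrix.diagonal t ∈ Matrix.unitaryGroup (Fin d) ℂ := by
      rw [Matrix.mem_unitaryGroup_iff, Matrix.star_eq_conjTranspose,
        Matrix.diagonal_conjTranspose, Matrix.diagonal_mul_diagonal, ← Matrix.diagonal_one]
      congr 1
      ext m
      by_cases hm : m = a <;> simp [t, hm]
    have h := hX ⟨_, ht⟩
    have hts : tensorSq (⟨_, ht⟩ : UGroup d) = Matrix.diagonal fun p => t p.1 * t p.2 :=
      Matrix.diagonal_kronecker_diagonal _ _
    have h' := congrFun (congrFun h p) q
    rw [hts, Matrix.diagonal_mul, Matrix.mul_diagonal, mul_comm] at h'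
    rcases eq_or_ne (X p q) 0 with h0 | h0
    · exact Or.inl h0
    · exact Or.inr (mul_left_cancel₀ h0 h')
  by_contra h0
  obtain ⟨i, j⟩ := p
  obtain ⟨k, l⟩ := q
  have hI1 : Complex.I ≠ 1 := fun h => by simpa using congrArg Complex.im h
  have hI2 : (-1 : ℂ) ≠ Complex.I := fun h => by simpa using congrArg Complex.im h
  have hI3 : (-1 : ℂ) ≠ 1 := by norm_num
  have ki := (key i).resolve_left h0
  have kj := (key j).resolve_left h0
  simp only [ne_eq, Prod.mk.injEq, Prod.swap_prod_mk, not_and] at h1 h2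
  dsimp only at ki kj
  rcases eq_or_ne i j with rfl | hij
  · by_cases hk : k = i <;> by_cases hl : l = i <;>
      simp [hk, hl, hI2, hI3] at ki h1 h2
  · by_cases hk : k = i
    · subst hk
      have hl : l ≠ j := fun h => h1 rfl h.symm
      simp [hij, hl, hI1] at kj
    · by_cases hl : l = i
      · subst hl
        have hk' : k ≠ j := fun h => h2 rfl h.symm
        simp [hij, hk', hI1] at kj
      · simp [hij.symm, hk, hl, hI1] at ki

/-- Permutation matrices are unitary, and their tensor squares permute both indices simultaneously.
-/
theorem apply_perm_of_commute {X : Matrix (Fin d × Fin d) (Fin d × Fin d) ℂ}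
    (hX : ∀ V : UGroup d, tensorSq V * X = X * tensorSq V) (σ : Equiv.Perm (Fin d))
    (i j k l : Fin d) : X (σ i, σ j) (σ k, σ l) = X (i, j) (k, l) := by
  have hσ : σ.permMatrix ℂ ∈ Matrix.unitaryGroup (Fin d) ℂ := by
    rw [Matrix.mem_unitaryGroup_iff, Matrix.star_eq_conjTranspose, Matrix.conjTranspose_permMatrix,
      ← Matrix.permMatrix_mul, inv_mul_cancel, Matrix.permMatrix_one]
  have h := congrFun (congrFun (hX ⟨_, hσ⟩) (i, j)) (σ k, σ l)
  simpa [Matrix.mul_apply, Fintype.sum_prod_type, tensorSq_apply, Equiv.Perm.permMatrix,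
    PEquiv.toMatrix_apply, ite_and, ← Finset.sum_mul, ← Finset.mul_sum] using h

/-- A unitary matrix without zero entries. -/
theorem exists_unitary_apply_ne_zero (hd : 1 ≤ d) :
    ∃ W : UGroup d, ∀ i j, (W : Matrix (Fin d) (Fin d) ℂ) i j ≠ 0 := by
  have hd0 : (d : ℂ) ≠ 0 := Nat.cast_ne_zero.2 (by omega)
  have hdr : (d : ℝ) ≠ 0 := Nat.cast_ne_zero.2 (by omega)
  -- With J the all-ones matrix, 1 + κJ is unitary when 2 Re κ + d|κ|² = 0. This κ solves the
  -- equation, and its imaginary part 1/d keeps every entry non-zero.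
  let κ : ℂ := (Complex.I - 1) / d
  let J : Matrix (Fin d) (Fin d) ℂ := Matrix.of fun _ _ => 1
  have hJJ : J * J = (d : ℂ) • J := by
    ext i j
    simp [J, Matrix.mul_apply]
  have hJs : star J = J := by
    ext i j
    simp [J, Matrix.star_apply]
  have hκ : κ + conj κ + κ * conj κ * d = 0 := by
    simp only [κ, map_div₀, map_sub, Complex.conj_I, map_one, map_natCast]
    field_simp
    linear_combination (-1 : ℂ) * Complex.I_sq
  have hW : 1 + κ • J ∈ Matrix.unitaryGroup (Fin d) ℂ := by
    rw [Matrix.mem_unitaryGroup_iff, star_add, star_one, star_smul, hJs]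
    have : (1 + κ • J) * (1 + star κ • J) = 1 + (κ + conj κ + κ * conj κ * d) • J := by
      simp only [add_mul, mul_add, one_mul, mul_one, smul_mul_assoc, mul_smul_comm, hJJ, smul_smul,
        RCLike.star_def, add_smul]
      module
    rw [this, hκ, zero_smul, add_zero]
  refine ⟨⟨_, hW⟩, fun i j h => ?_⟩
  have h1 := congrArg Complex.im h
  have hκim : κ.im = (d : ℝ)⁻¹ := by
    simp [κ, Complex.div_natCast_im]
  rcases eq_or_ne i j with rfl | hij
  · simp [J, hκim, hdr] at h1
  · simp [J, hij, hκim, hdr] at h1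

/-- Schur-Weyl duality for the tensor square of the unitary group. -/
theorem exists_eq_smul_add_smul_swapMatrix (hd : 1 ≤ d)
    {X : Matrix (Fin d × Fin d) (Fin d × Fin d) ℂ}
    (hX : ∀ V : UGroup d, tensorSq V * X = X * tensorSq V) :
    ∃ a b : ℂ, X = a • 1 + b • swapMatrix d := by
  obtain rfl | hd2 : d = 1 ∨ 2 ≤ d := by omega
  · refine ⟨X 0 0, 0, ?_⟩
    ext p q
    rw [Subsingleton.elim p 0, Subsingleton.elim q 0]
    simp
  let i₀ : Fin d := ⟨0, by omega⟩
  let i₁ : Fin d := ⟨1, by omega⟩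
  have hi : i₀ ≠ i₁ := by simp [i₀, i₁]
  obtain ⟨W, hW⟩ := exists_unitary_apply_ne_zero hd
  set b := X (i₀, i₁) (i₀, i₁) with hb
  set c := X (i₀, i₁) (i₁, i₀) with hc
  -- Diagonal and permutation matrices cannot give this relation: they also commute with the
  -- projection onto the span of the e_i ⊗ e_i. A unitary without zero entries links the three
  -- values.
  have hdiag : X (i₀, i₀) (i₀, i₀) = b + c := by
    have h := congrFun (congrFun (hX W) (i₀, i₀)) (i₀, i₁)
    have hl : (tensorSq W * X) (i₀, i₀) (i₀, i₁) =
        W.1 i₀ i₀ * W.1 i₀ i₁ * (b + c) := by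
      rw [Matrix.mul_apply, ← Finset.sum_subset (Finset.subset_univ {(i₀, i₁), (i₁, i₀)})]
      · rw [Finset.sum_pair (by simp [hi]), tensorSq_apply, tensorSq_apply]
        have := apply_perm_of_commute hX (Equiv.swap i₀ i₁) i₀ i₁ i₁ i₀
        simp only [Equiv.swap_apply_left, Equiv.swap_apply_right] at this
        rw [this]
        ring
      · intro p _ hp
        simp only [Finset.mem_insert, Finset.mem_singleton, not_or] at hp
        rw [apply_eq_zero_of_commute_diagonal hX hp.1 hp.2, mul_zero]
    have hr : (X * tensorSq W) (i₀, i₀) (i₀, i₁) =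
        W.1 i₀ i₀ * W.1 i₀ i₁ * X (i₀, i₀) (i₀, i₀) := by
      rw [Matrix.mul_apply, Finset.sum_eq_single (i₀, i₀)]
      · rw [tensorSq_apply]
        ring
      · intro p _ hp
        rw [apply_eq_zero_of_commute_diagonal hX hp.symm, zero_mul]
        intro h'
        exact hp (by rw [← Prod.swap_swap p, ← h']; rfl)
      · simp
    rw [hl, hr] at h
    exact (mul_left_cancel₀ (mul_ne_zero (hW _ _) (hW _ _)) h).symm
  -- Two-transitivity of the symmetric group reduces all off-diagonal pairs to (i₀, i₁).
  have htrans : ∀ {i j : Fin d}, i ≠ j → ∃ σ : Equiv.Perm (Fin d), σ i₀ = i ∧ σ i₁ = j :=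
    fun {i j} hij => MulAction.is_two_pretransitive_iff.1
      (Equiv.Perm.isMultiplyPretransitive (Fin d) 2) hi hij
  refine ⟨b, c, ?_⟩
  ext ⟨i, j⟩ ⟨k, l⟩
  simp only [Matrix.add_apply, Matrix.smul_apply, smul_eq_mul, swapMatrix_apply, Matrix.one_apply,
    Prod.swap_prod_mk, Prod.mk.injEq]
  by_cases h1 : i = k ∧ j = l
  · obtain ⟨rfl, rfl⟩ := h1
    by_cases hij : i = j
    · subst hij
      have := apply_perm_of_commute hX (Equiv.swap i₀ i) i₀ i₀ i₀ i₀
      rw [Equiv.swap_apply_left] at this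
      simp [this, hdiag]
    · obtain ⟨σ, rfl, rfl⟩ := htrans hij
      rw [apply_perm_of_commute hX]
      simp [hi, hi.symm, hb]
  · by_cases h2 : j = k ∧ i = l
    · obtain ⟨rfl, rfl⟩ := h2
      have hij : i ≠ j := fun h => h1 ⟨h, h.symm⟩
      obtain ⟨σ, rfl, rfl⟩ := htrans hij
      rw [apply_perm_of_commute hX]
      simp [hi, hc]
    · rw [apply_eq_zero_of_commute_diagonal hX (by simpa using h1)
        (by simpa [and_comm, eq_comm] using h2)]
      simp [h1, h2]

/-- For d ≥ 2 the entries with second indices k = l ≠ i read off A i i = a without the flip; those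
with k = l = j make A i j vanish for i ≠ j. -/
theorem exists_eq_smul_one_of_kronecker_one (hd : 1 ≤ d) {A : Matrix (Fin d) (Fin d) ℂ} {a b : ℂ}
    (h : A ⊗ₖ (1 : Matrix (Fin d) (Fin d) ℂ) = a • 1 + b • swapMatrix d) :
    ∃ c : ℂ, A = c • 1 := by
  obtain rfl | hd2 : d = 1 ∨ 2 ≤ d := by omega
  · refine ⟨A 0 0, ?_⟩
    ext i j
    rw [Subsingleton.elim i 0, Subsingleton.elim j 0]
    simp
  · have hent : ∀ i k j l : Fin d, A i j * (1 : Matrix (Fin d) (Fin d) ℂ) k l =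
        a * (if i = j ∧ k = l then 1 else 0) + b * (if k = j ∧ i = l then 1 else 0) := by
      intro i k j l
      have := congrFun (congrFun h (i, k)) (j, l)
      simpa [Matrix.one_apply, swapMatrix_apply] using this
    refine ⟨a, ?_⟩
    ext i j
    by_cases hij : i = j
    · subst hij
      have : Nontrivial (Fin d) := Fin.nontrivial_iff_two_le.2 hd2
      obtain ⟨k, hk⟩ := exists_ne i
      simpa [hk] using hent i k i k
    · simpa [hij] using hent i j j j

end Swap

/-! ### The Haar twirl -/

section Twirl

variable {d : ℕ}

instance : (haarU d).IsHaarMeasure := by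
  unfold haarU
  infer_instance

/-- A right translate of Haar measure is again a left-invariant probability measure, hence equal to
it by uniqueness. -/
instance : (haarU d).IsMulRightInvariant where
  map_mul_right_eq_self g := by
    have : IsProbabilityMeasure ((haarU d).map (· * g)) :=
      Measure.isProbabilityMeasure_map (measurable_mul_const g).aemeasurable
    exact Measure.isHaarMeasure_eq_of_isProbabilityMeasure _ _

theorem integrable_conj_apply (X : Matrix (Fin d × Fin d) (Fin d × Fin d) ℂ) (p q : Fin d × Fin d) :
    Integrable (fun V : UGroup d => (tensorSq V * X * (tensorSq V)ᴴ) p q) (haarU d) := by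
  refine Continuous.integrable_of_hasCompactSupport ?_ (HasCompactSupport.of_compactSpace _)
  have h : ∀ i j, Continuous fun V : UGroup d => (V : Matrix (Fin d) (Fin d) ℂ) i j := fun i j =>
    continuous_subtype_val.matrix_elem i j
  simp only [Matrix.mul_apply, tensorSq_apply, Matrix.conjTranspose_apply]
  exact continuous_finsetSum _ fun j _ => (continuous_finsetSum _ fun k _ =>
    ((h _ _).mul (h _ _)).mul continuous_const).mul ((h _ _).mul (h _ _)).star

/-- The average of `(V ⊗ V) X (V ⊗ V)†` over the unitary group. -/
noncomputable def haarTwirl (X : Matrix (Fin d × Fin d) (Fin d × Fin d) ℂ) :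
    Matrix (Fin d × Fin d) (Fin d × Fin d) ℂ :=
  Matrix.of fun p q => ∫ V : UGroup d, (tensorSq V * X * (tensorSq V)ᴴ) p q ∂(haarU d)

theorem haarTwirl_apply (X : Matrix (Fin d × Fin d) (Fin d × Fin d) ℂ) (p q : Fin d × Fin d) :
    haarTwirl X p q = ∫ V : UGroup d, (tensorSq V * X * (tensorSq V)ᴴ) p q ∂(haarU d) := rfl

theorem tensorSq_mul_haarTwirl (W : UGroup d) (X : Matrix (Fin d × Fin d) (Fin d × Fin d) ℂ) :
    tensorSq W * haarTwirl X = haarTwirl X * tensorSq W := by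
  rw [← tensorSq_mul_mul_conjTranspose_eq_iff]
  ext p q
  have h1 : haarTwirl X p q =
      ∫ V : UGroup d, (tensorSq (W * V) * X * (tensorSq (W * V))ᴴ) p q ∂(haarU d) :=
    (integral_mul_left_eq_self (fun V : UGroup d => (tensorSq V * X * (tensorSq V)ᴴ) p q) W).symm
  have h2 : ∀ V : UGroup d, (tensorSq (W * V) * X * (tensorSq (W * V))ᴴ) p q =
      ∑ k, (∑ l, tensorSq W p l * (tensorSq V * X * (tensorSq V)ᴴ) l k) * (tensorSq W)ᴴ k q := by
    intro V
    rw [tensorSq_mul, Matrix.conjTranspose_mul]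
    have : tensorSq W * tensorSq V * X * ((tensorSq V)ᴴ * (tensorSq W)ᴴ) =
        tensorSq W * (tensorSq V * X * (tensorSq V)ᴴ) * (tensorSq W)ᴴ := by
      simp only [mul_assoc]
    rw [this, Matrix.mul_apply]
    simp_rw [Matrix.mul_apply (M := tensorSq W)]
  have hint := integrable_conj_apply X
  rw [h1, Matrix.mul_apply]
  simp_rw [h2]
  rw [integral_finsetSum _ fun k _ =>
    (integrable_finsetSum _ fun l _ => (hint l k).const_mul _).mul_const _]
  refine Finset.sum_congr rfl fun k _ => ?_
  rw [integral_mul_const, integral_finsetSum _ fun l _ => (hint l k).const_mul _, Matrix.mul_apply]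
  simp_rw [integral_const_mul, haarTwirl_apply]

theorem haarTwirl_conj (W : UGroup d) (X : Matrix (Fin d × Fin d) (Fin d × Fin d) ℂ) :
    haarTwirl (tensorSq W * X * (tensorSq W)ᴴ) = haarTwirl X := by
  ext p q
  rw [haarTwirl_apply, haarTwirl_apply, 
    ← integral_mul_right_eq_self (fun V : UGroup d => (tensorSq V * X * (tensorSq V)ᴴ) p q) W]
  simp only [tensorSq_mul, Matrix.conjTranspose_mul, mul_assoc]

theorem haarTwirl_smul (c : ℂ) (X : Matrix (Fin d × Fin d) (Fin d × Fin d) ℂ) :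
    haarTwirl (c • X) = c • haarTwirl X := by
  ext p q
  simp only [haarTwirl_apply, Matrix.smul_apply, Matrix.mul_smul, Matrix.smul_mul]
  exact integral_const_mul c _

theorem haarTwirl_sum {ι : Type*} (s : Finset ι)
    (X : ι → Matrix (Fin d × Fin d) (Fin d × Fin d) ℂ) :
    haarTwirl (∑ i ∈ s, X i) = ∑ i ∈ s, haarTwirl (X i) := by
  ext p q
  rw [Matrix.sum_apply]
  simp only [haarTwirl_apply, Finset.mul_sum, Finset.sum_mul, Matrix.sum_apply]
  exact integral_finsetSum _ fun i _ => integrable_conj_apply (X i) p q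

theorem haarTwirl_eq_self {X : Matrix (Fin d × Fin d) (Fin d × Fin d) ℂ}
    (hX : ∀ V : UGroup d, tensorSq V * X = X * tensorSq V) : haarTwirl X = X := by
  ext p q
  simp_rw [haarTwirl_apply, fun V => (tensorSq_mul_mul_conjTranspose_eq_iff V X).2 (hX V)]
  simp

end Twirl

/-! ### The commutant of the tensor square and the design property -/

section Commutant

variable {G : Type*} [Group G] {d : ℕ}

/-- The commutant of the tensor square of a unitary representation. -/
def tensorSqCommutant (U : G →* UGroup d) :
    Submodule ℂ (Matrix (Fin d × Fin d) (Fin d × Fin d) ℂ) where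
  carrier := {X | ∀ g, tensorSq (U g) * X = X * tensorSq (U g)}
  zero_mem' := fun g => by simp
  add_mem' := fun {X Y} hX hY g => by rw [mul_add, add_mul, hX g, hY g]
  smul_mem' := fun c X hX g => by rw [mul_smul_comm, smul_mul_assoc, hX g]

theorem one_mem_tensorSqCommutant (U : G →* UGroup d) : 1 ∈ tensorSqCommutant U :=
  fun g => by rw [mul_one, one_mul]

theorem swapMatrix_mem_tensorSqCommutant (U : G →* UGroup d) :
    swapMatrix d ∈ tensorSqCommutant U := fun g => tensorSq_mul_swapMatrix (U g)

theorem kronecker_one_mem_tensorSqCommutant {U : G →* UGroup d} {A : Matrix (Fin d) (Fin d) ℂ}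
    (hA : ∀ g, A * U g = U g * A) :
    A ⊗ₖ (1 : Matrix (Fin d) (Fin d) ℂ) ∈ tensorSqCommutant U := fun g => by
  rw [tensorSq, ← Matrix.mul_kronecker_mul, ← Matrix.mul_kronecker_mul, hA, one_mul, mul_one]

/-- Passing to matrices in the product basis turns the commutant into the space of
self-intertwiners, whose dimension is a character pairing. -/
theorem finrank_tensorSqCommutant (U : G →* UGroup d) :
    finrank ℂ (tensorSqCommutant U) = finrank ℂ (IntertwiningMap (rep2 U) (rep2 U)) := by
  let b := (Pi.basisFun ℂ (Fin d)).tensorProduct (Pi.basisFun ℂ (Fin d))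
  let e := LinearMap.toMatrix b b
  have hU : ∀ g, e (rep2 U g) = tensorSq (U g) := fun g => by
    change LinearMap.toMatrix _ _ (TensorProduct.map _ _) = _
    rw [TensorProduct.toMatrix_map]
    change Matrix.kroneckerMap _ (LinearMap.toMatrix' (Matrix.toLin' _))
      (LinearMap.toMatrix' (Matrix.toLin' _)) = _
    rw [LinearMap.toMatrix'_toLin']
    rfl
  have hcomm : ∀ f, e f ∈ tensorSqCommutant U ↔ ∀ g, rep2 U g ∘ₗ f = f ∘ₗ rep2 U g := fun f => by
    refine forall_congr' fun g => ?_
    rw [← hU, ← LinearMap.toMatrix_comp, ← LinearMap.toMatrix_comp, e.injective.eq_iff]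
  let φ : IntertwiningMap (rep2 U) (rep2 U) ≃ₗ[ℂ] tensorSqCommutant U :=
    { toFun := fun f => ⟨e f.toLinearMap, (hcomm _).2 fun g => (f.isIntertwining' g).symm⟩
      map_add' := fun f f' => Subtype.ext (map_add e _ _)
      map_smul' := fun c f => Subtype.ext (map_smul e c _)
      invFun := fun X => ⟨e.symm X, fun g => ((hcomm _).1 (by
        rw [LinearEquiv.apply_symm_apply]; exact X.2) g).symm⟩
      left_inv := fun f => IntertwiningMap.ext (e.symm_apply_apply _)
      right_inv := fun X => Subtype.ext (e.apply_symm_apply _) }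
  exact φ.finrank_eq.symm

theorem linearIndependent_one_swapMatrix (hd : 2 ≤ d) :
    LinearIndependent ℂ ![1, swapMatrix d] := by
  rw [LinearIndependent.pair_iff]
  intro a b h
  let i₀ : Fin d := ⟨0, by omega⟩
  let i₁ : Fin d := ⟨1, by omega⟩
  have h1 := congrFun (congrFun h (i₀, i₁)) (i₀, i₁)
  have h2 := congrFun (congrFun h (i₀, i₁)) (i₁, i₀)
  constructor
  · simpa [swapMatrix_apply, i₀, i₁] using h1
  · simpa [swapMatrix_apply, i₀, i₁, Matrix.one_apply] using h2

theorem span_le_tensorSqCommutant (U : G →* UGroup d) :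
    Submodule.span ℂ (Set.range ![1, swapMatrix d]) ≤ tensorSqCommutant U := by
  rw [Submodule.span_le]
  rintro _ ⟨i, rfl⟩
  fin_cases i
  · exact one_mem_tensorSqCommutant U
  · exact swapMatrix_mem_tensorSqCommutant U

theorem finrank_tensorSqCommutant_eq_two_iff (hd : 2 ≤ d) (U : G →* UGroup d) :
    finrank ℂ (tensorSqCommutant U) = 2 ↔
      ∀ X ∈ tensorSqCommutant U, ∃ a b : ℂ, X = a • 1 + b • swapMatrix d := by
  have h2 : finrank ℂ (Submodule.span ℂ (Set.range ![1, swapMatrix d])) = 2 :=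
    finrank_span_eq_card (linearIndependent_one_swapMatrix hd)
  constructor
  · intro h X hX
    rw [← Submodule.eq_of_le_of_finrank_eq (span_le_tensorSqCommutant U) (h2.trans h.symm)] at hX
    simp only [Matrix.range_cons, Matrix.range_empty, Set.union_empty, Set.singleton_union,
      Submodule.mem_span_pair] at hX
    obtain ⟨a, b, h⟩ := hX
    exact ⟨a, b, h.symm⟩
  · intro h
    rw [← h2, le_antisymm (fun X hX => ?_) (span_le_tensorSqCommutant U)]
    obtain ⟨a, b, rfl⟩ := h X hX
    exact add_mem (Submodule.smul_mem _ _ (Submodule.subset_span ⟨0, rfl⟩))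
      (Submodule.smul_mem _ _ (Submodule.subset_span ⟨1, rfl⟩))

theorem isIrreducible_of_tensorSqCommutant [Fintype G] (hd : 1 ≤ d) {U : G →* UGroup d}
    (h : ∀ X ∈ tensorSqCommutant U, ∃ a b : ℂ, X = a • 1 + b • swapMatrix d) :
    (rep U).IsIrreducible := by
  refine isIrreducible_rep_of_commutant hd fun A hA => ?_
  obtain ⟨a, b, hab⟩ := h _ (kronecker_one_mem_tensorSqCommutant hA)
  exact exists_eq_smul_one_of_kronecker_one hd hab

/-- Averaging X over D leaves it unchanged, so the design property makes X its own Haar twirl. It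
then commutes with every V ⊗ V, and Schur-Weyl duality applies. -/
theorem IsUnitaryTwoDesign.tensorSqCommutant_le (hd : 1 ≤ d) {D : Finset (UGroup d)}
    (h : IsUnitaryTwoDesign D) {U : G →* UGroup d} (hD : ∀ x ∈ D, x ∈ Set.range U) :
    ∀ X ∈ tensorSqCommutant U, ∃ a b : ℂ, X = a • 1 + b • swapMatrix d := by
  intro X hX
  have hT : haarTwirl X = X := by
    ext p q
    rw [haarTwirl_apply, ← h.2 X p q]
    have h1 : ∀ x ∈ D, (tensorSq x * X * (tensorSq x)ᴴ) p q = X p q := fun x hx => by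
      obtain ⟨g, rfl⟩ := hD x hx
      rw [(tensorSq_mul_mul_conjTranspose_eq_iff _ _).2 (hX g)]
    rw [Finset.sum_congr rfl h1, Finset.sum_const, nsmul_eq_mul,
      inv_mul_cancel_left₀ (Nat.cast_ne_zero.2 (Finset.card_pos.2 h.1).ne')]
  exact exists_eq_smul_add_smul_swapMatrix hd fun V => by
    rw [← hT, tensorSq_mul_haarTwirl]

/-- The group average E of X is fixed by the Haar twirl, and by right invariance it has the same
twirl as X. Irreducibility makes the center scalar, and scalar phases cancel under conjugation, so E
is also the average over D. -/
theorem IsInducedBy.isUnitaryTwoDesign [Fintype G] (hd : 1 ≤ d) {D : Finset (UGroup d)}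
    {U : G →* UGroup d} (hD : IsInducedBy D U)
    (h : ∀ X ∈ tensorSqCommutant U, ∃ a b : ℂ, X = a • 1 + b • swapMatrix d) :
    IsUnitaryTwoDesign D := by
  have hirr := isIrreducible_of_tensorSqCommutant hd h
  refine ⟨hD.isCosetTransversal.nonempty, fun X p q => ?_⟩
  let E : Matrix (Fin d × Fin d) (Fin d × Fin d) ℂ :=
    (Nat.card G : ℂ)⁻¹ • ∑ g, tensorSq (U g) * X * (tensorSq (U g))ᴴ
  have hE : E ∈ tensorSqCommutant U := by
    refine Submodule.smul_mem _ _ fun g => ?_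
    rw [← tensorSq_mul_mul_conjTranspose_eq_iff, Finset.mul_sum, Finset.sum_mul]
    refine Fintype.sum_equiv (Equiv.mulLeft g) _ _ fun k => ?_
    rw [Equiv.coe_mulLeft, map_mul, tensorSq_mul, Matrix.conjTranspose_mul]
    simp only [mul_assoc]
  have hTE : haarTwirl E = E := by
    obtain ⟨a, b, hab⟩ := h E hE
    refine haarTwirl_eq_self fun V => ?_
    rw [hab, mul_add, add_mul, mul_smul_comm, mul_smul_comm, smul_mul_assoc, smul_mul_assoc,
      tensorSq_mul_swapMatrix, mul_one, one_mul]
  have hTX : haarTwirl E = haarTwirl X := by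
    rw [haarTwirl_smul, haarTwirl_sum]
    simp_rw [haarTwirl_conj]
    rw [Finset.sum_const, Finset.card_univ, ← Nat.card_eq_fintype_card, ← Nat.cast_smul_eq_nsmul ℂ,
      smul_smul, inv_mul_cancel₀ (Nat.cast_ne_zero.2 Nat.card_pos.ne'), one_smul]
  rw [← haarTwirl_apply, ← hTX, hTE,
    ← hD.isCosetTransversal.average_eq (fun V => (tensorSq V * X * (tensorSq V)ᴴ) p q)]
  · simp [E, Matrix.sum_apply]
  · intro x n hn
    obtain ⟨c, hc, hcn⟩ :=
      exists_coe_eq_smul_one_of_mem_repCenter hd hirr (mem_centerPreimage.1 hn)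
    have h1 : tensorSq (x * U n) = (c * c) • tensorSq x := by
      rw [tensorSq_mul]
      change _ * (U n).1 ⊗ₖ (U n).1 = _
      rw [hcn, Matrix.smul_kronecker, Matrix.kronecker_smul, Matrix.one_kronecker_one, smul_smul,
        mul_smul_comm, mul_one]
    have h2 : conj c * c = 1 := by rw [Complex.conj_mul', hc]; simp
    have h3 : star (c * c) * (c * c) = 1 := by
      rw [RCLike.star_def, map_mul]
      linear_combination (conj c * c + 1) * h2
    rw [h1, Matrix.conjTranspose_smul, smul_mul_assoc, smul_mul_assoc, mul_smul_comm, smul_smul,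
      mul_comm (c * c), h3, one_smul]

end Commutant

/-! ### Symmetric and alternating squares -/

section SymAlt

variable {G : Type*} [Group G] {d : ℕ}

/-- The flip of `ℂ^d ⊗ ℂ^d`. -/
noncomputable def flip (d : ℕ) : Module.End ℂ (TensorProduct ℂ (Fin d → ℂ) (Fin d → ℂ)) :=
  (TensorProduct.comm ℂ (Fin d → ℂ) (Fin d → ℂ)).toLinearMap

theorem flip_flip (v : TensorProduct ℂ (Fin d → ℂ) (Fin d → ℂ)) : flip d (flip d v) = v :=
  (TensorProduct.comm ℂ (Fin d → ℂ) (Fin d → ℂ)).symm_apply_apply v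

theorem flip_rep2 (U : G →* UGroup d) (g : G) (v : TensorProduct ℂ (Fin d → ℂ) (Fin d → ℂ)) :
    flip d (rep2 U g v) = rep2 U g (flip d v) := by
  induction v with
  | zero => simp
  | add x y hx hy => simp only [map_add, hx, hy]
  | tmul x y => rfl

/-- An eigenspace of the flip, as a subrepresentation of the tensor square. -/
noncomputable def flipEigenspace (U : G →* UGroup d) (ε : ℂ) : Subrepresentation (rep2 U) where
  toSubmodule := (flip d).eigenspace ε
  apply_mem_toSubmodule := fun g v hv => by
    rw [Module.End.mem_eigenspace_iff] at hv ⊢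
    rw [flip_rep2, hv, map_smul]

/-- The symmetric square of a unitary representation. -/
noncomputable abbrev symSub (U : G →* UGroup d) : Subrepresentation (rep2 U) := flipEigenspace U 1

/-- The alternating square of a unitary representation. -/
noncomputable abbrev altSub (U : G →* UGroup d) : Subrepresentation (rep2 U) :=
  flipEigenspace U (-1)

/-- The representation on an eigenspace of the flip. The instance on the carrier is written as
that of an additive commutative group, as character theory expects. -/
noncomputable def flipRep (U : G →* UGroup d) (ε : ℂ) :
    @Representation ℂ G (flipEigenspace U ε).toSubmodule _ _ AddCommGroup.toAddCommMonoid
      (inferInstanceAs (Module ℂ (flipEigenspace U ε).toSubmodule)) :=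
  (flipEigenspace U ε).toRepresentation

/-- The representation on the symmetric square. -/
noncomputable abbrev symRep (U : G →* UGroup d) := flipRep U 1

/-- The representation on the alternating square. -/
noncomputable abbrev altRep (U : G →* UGroup d) := flipRep U (-1)

theorem isCompl_symSub_altSub (U : G →* UGroup d) : IsCompl (symSub U) (altSub U) := by
  rw [← isCompl_toSubmodule_iff]
  change IsCompl ((flip d).eigenspace 1) ((flip d).eigenspace (-1))
  constructor
  · rw [Submodule.disjoint_def]
    intro v h1 h2
    rw [Module.End.mem_eigenspace_iff] at h1 h2
    rw [h1, one_smul, neg_smul, one_smul] at h2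
    have h3 : (2 : ℂ) • v = 0 := by
      rw [two_smul, ← sub_neg_eq_add, ← h2, sub_self]
    exact (smul_eq_zero.1 h3).resolve_left two_ne_zero
  · rw [codisjoint_iff, eq_top_iff]
    intro v _
    rw [Submodule.mem_sup]
    refine ⟨(2 : ℂ)⁻¹ • (v + flip d v), ?_, (2 : ℂ)⁻¹ • (v - flip d v), ?_, by module⟩
    · rw [Module.End.mem_eigenspace_iff, map_smul, map_add, flip_flip]
      module
    · rw [Module.End.mem_eigenspace_iff, map_smul, map_sub, flip_flip]
      module

theorem isInternal_symSub_altSub (U : G →* UGroup d) :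
    DirectSum.IsInternal fun i : Fin 2 => (flipEigenspace U (![1, -1] i)).toSubmodule :=
  (DirectSum.isInternal_submodule_iff_isCompl _ (i := (0 : Fin 2)) (j := 1) (by decide)
    (by ext i; fin_cases i <;> simp)).2 (isCompl_toSubmodule_iff.2 (isCompl_symSub_altSub U))

theorem trace_eq_add_of_isInternal {V : Type*} [AddCommGroup V] [Module ℂ V]
    [FiniteDimensional ℂ V] {N : Fin 2 → Submodule ℂ V} (h : DirectSum.IsInternal N)
    {f : V →ₗ[ℂ] V} (hf : ∀ i, ∀ v ∈ N i, f v ∈ N i) :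
    LinearMap.trace ℂ V f = LinearMap.trace ℂ (N 0) (f.restrict (hf 0)) +
      LinearMap.trace ℂ (N 1) (f.restrict (hf 1)) := by
  rw [LinearMap.trace_eq_sum_trace_restrict h hf, Fin.sum_univ_two]

/-- In the basis e_i ⊗ e_j the trace is the sum of all u_ij u_ji, which is tr(u²). -/
theorem trace_flip_comp_rep2 (U : G →* UGroup d) (g : G) :
    LinearMap.trace ℂ _ (flip d ∘ₗ rep2 U g) = (rep U).character (g ^ 2) := by
  let b := (Pi.basisFun ℂ (Fin d)).tensorProduct (Pi.basisFun ℂ (Fin d))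
  rw [LinearMap.trace_eq_matrix_trace ℂ b, character_rep, sq, map_mul, Matrix.trace,
    Fintype.sum_prod_type]
  change _ = Matrix.trace ((U g).1 * (U g).1)
  refine Finset.sum_congr rfl fun i _ => ?_
  rw [Matrix.diag_apply, Matrix.mul_apply]
  refine Finset.sum_congr rfl fun j _ => ?_
  rw [Matrix.diag_apply, LinearMap.toMatrix_apply, Basis.tensorProduct_apply]
  change (b.repr ((rep U g (Pi.basisFun ℂ (Fin d) j)) ⊗ₜ
    (rep U g (Pi.basisFun ℂ (Fin d) i)))) (i, j) = _
  rw [Basis.tensorProduct_repr_tmul_apply]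
  simp [rep, mul_comm]

theorem character_symSub_add_altSub (U : G →* UGroup d) (g : G) :
    (symRep U).character g + (altRep U).character g =
      (rep2 U).character g := by
  exact (trace_eq_add_of_isInternal (isInternal_symSub_altSub U) (f := rep2 U g)
    fun i => (flipEigenspace U (![1, -1] i)).apply_mem_toSubmodule g).symm

/-- The flip acts by 1 and -1 on the two summands, so composing with it before taking the trace
turns the sum of the two characters into their difference. -/
theorem character_symSub_sub_altSub (U : G →* UGroup d) (g : G) :
    (symRep U).character g - (altRep U).character g =
      (rep U).character (g ^ 2) := by
  have hmem : ∀ (ε : ℂ), ∀ v ∈ (flipEigenspace U ε).toSubmodule,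
      (flip d ∘ₗ rep2 U g) v = ε • rep2 U g v := fun ε v hv =>
    Module.End.mem_eigenspace_iff.1 ((flipEigenspace U ε).apply_mem_toSubmodule g hv)
  have hmaps : ∀ (ε : ℂ), ∀ v ∈ (flipEigenspace U ε).toSubmodule,
      (flip d ∘ₗ rep2 U g) v ∈ (flipEigenspace U ε).toSubmodule := fun ε v hv => by
    rw [hmem ε v hv]
    exact Submodule.smul_mem _ _ ((flipEigenspace U ε).apply_mem_toSubmodule g hv)
  have hres : ∀ ε : ℂ, LinearMap.trace ℂ _ ((flip d ∘ₗ rep2 U g).restrict (hmaps ε)) =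
      ε * (flipRep U ε).character g := fun ε => by
    have : (flip d ∘ₗ rep2 U g).restrict (hmaps ε) = ε • (flipEigenspace U ε).toRepresentation g :=
      LinearMap.ext fun v => Subtype.ext (hmem ε v v.2)
    rw [this, map_smul]
    rfl
  have h : _ = 1 * (symRep U).character g + (-1) * (altRep U).character g :=
    (trace_eq_add_of_isInternal (isInternal_symSub_altSub U)
      (f := flip d ∘ₗ rep2 U g) fun i => hmaps (![1, -1] i)).trans
    (congrArg₂ (· + ·) (hres 1) (hres (-1)))
  rw [trace_flip_comp_rep2] at h
  rw [h]
  ring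

theorem character_symSub (U : G →* UGroup d) :
    (symRep U).character = symSquare (rep U).character := by
  ext g
  have h1 := character_symSub_add_altSub U g
  have h2 := character_symSub_sub_altSub U g
  rw [character_rep2] at h1
  rw [symSquare, ← h1, ← h2]
  ring

theorem character_altSub (U : G →* UGroup d) :
    (altRep U).character = altSquare (rep U).character := by
  ext g
  have h1 := character_symSub_add_altSub U g
  have h2 := character_symSub_sub_altSub U g
  rw [character_rep2] at h1
  rw [altSquare, ← h1, ← h2]
  ring

theorem finrank_symSub (U : G →* UGroup d) :
    2 * finrank ℂ (symSub U).toSubmodule = d * (d + 1) := by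
  have h := char_one (symRep U)
  rw [character_symSub, symSquare, one_pow, char_one, finrank_fin_fun] at h
  have : (2 : ℂ) * finrank ℂ (symSub U).toSubmodule = d * (d + 1) := by
    rw [← h]
    ring
  exact_mod_cast this

theorem finrank_altSub (U : G →* UGroup d) :
    2 * finrank ℂ (altSub U).toSubmodule = d * (d - 1) := by
  have h := char_one (altRep U)
  rw [character_altSub, altSquare, one_pow, char_one, finrank_fin_fun] at h
  -- The additive form avoids casting the truncated subtraction d - 1.
  have h1 : (2 : ℂ) * finrank ℂ (altSub U).toSubmodule + d = d * d := by
    rw [← h]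
    ring
  have h2 : 2 * finrank ℂ (altSub U).toSubmodule + d = d * d := by exact_mod_cast h1
  rw [Nat.mul_sub, mul_one]
  omega

theorem symSub_ne_bot (hd : 1 ≤ d) (U : G →* UGroup d) : symSub U ≠ ⊥ := fun h => by
  have h1 := finrank_symSub U
  rw [h] at h1
  change 2 * finrank ℂ (⊥ : Submodule ℂ _) = _ at h1
  rw [finrank_bot] at h1
  have : 0 < d * (d + 1) := by positivity
  omega

theorem altSub_ne_bot (hd : 2 ≤ d) (U : G →* UGroup d) : altSub U ≠ ⊥ := fun h => by
  have h1 := finrank_altSub U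
  rw [h] at h1
  change 2 * finrank ℂ (⊥ : Submodule ℂ _) = _ at h1
  rw [finrank_bot] at h1
  have : 0 < d * (d - 1) := Nat.mul_pos (by omega) (by omega)
  omega

theorem finrank_symSub_ne_finrank_altSub (hd : 1 ≤ d) (U : G →* UGroup d) :
    finrank ℂ (symSub U).toSubmodule ≠ finrank ℂ (altSub U).toSubmodule := fun h => by
  have h1 := finrank_symSub U
  rw [h, finrank_altSub, Nat.mul_right_inj (by omega)] at h1
  omega

/-! ### Criteria for designs and their consequences -/

theorem hasIrreducibleComponents_rep2 {U : G →* UGroup d}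
    (hS : (symRep U).IsIrreducible)
    (hA : (altRep U).IsIrreducible) : HasIrreducibleComponents (rep2 U) 2 :=
  ⟨_, isInternal_symSub_altSub U, fun i => by
    fin_cases i
    · exact hS
    · exact hA⟩

theorem finrank_intertwiningMap_self_pos {V : Type*} [AddCommGroup V] [Module ℂ V]
    [FiniteDimensional ℂ V] {ρ : Representation ℂ G V} (h : finrank ℂ V ≠ 0) :
    0 < finrank ℂ (IntertwiningMap ρ ρ) := by
  have : Nontrivial V := nontrivial_of_finrank_pos (Nat.pos_of_ne_zero h)
  have : FiniteDimensional ℂ (IntertwiningMap ρ ρ) :=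
    Module.Finite.of_injective (IntertwiningMap.toLinearMapl ρ ρ)
      (IntertwiningMap.toLinearMap_injective ρ ρ)
  obtain ⟨v, hv⟩ := exists_ne (0 : V)
  exact finrank_pos_iff_exists_ne_zero.2 ⟨IntertwiningMap.id ρ, fun h0 =>
    hv (by simpa using congrArg (fun f : IntertwiningMap ρ ρ => f v) h0)⟩

/-- The norm is a sum of four dimensions of intertwiner spaces. The two diagonal ones are at least
1, so the total 2 makes them exactly 1. Conversely, unequal dimensions kill the mixed terms. -/
theorem charInner_rep2_eq_two_iff [Fintype G] (hd : 2 ≤ d) (U : G →* UGroup d) :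
    charInner (rep2 U).character (rep2 U).character = 2 ↔
      (symRep U).IsIrreducible ∧ (altRep U).IsIrreducible := by
  have hsum : (rep2 U).character =
      (symRep U).character + (altRep U).character :=
    funext fun g => (character_symSub_add_altSub U g).symm
  rw [charInner_rep2, hsum]
  simp only [charPairing_add_left, charPairing_add_right]
  constructor
  · intro h
    rw [isIrreducible_iff_charPairing, isIrreducible_iff_charPairing]
    have hd' : 0 < d * (d - 1) := Nat.mul_pos (by omega) (by omega)
    have hS := finrank_symSub U
    have hA := finrank_altSub U
    have hd'' : 0 < d * (d + 1) := by positivity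
    have hS0 : finrank ℂ (symSub U).toSubmodule ≠ 0 := by omega
    have hA0 : finrank ℂ (altSub U).toSubmodule ≠ 0 := by omega
    have h1 := finrank_intertwiningMap_self_pos (ρ := symRep U) hS0
    have h2 := finrank_intertwiningMap_self_pos (ρ := altRep U) hA0
    simp only [charPairing_character] at h ⊢
    norm_cast at h ⊢
    omega
  · rintro ⟨hS, hA⟩
    rw [(isIrreducible_iff_charPairing _).1 hS, (isIrreducible_iff_charPairing _).1 hA,
      charPairing_eq_zero hS hA (finrank_symSub_ne_finrank_altSub (by omega) U),
      charPairing_eq_zero hA hS (finrank_symSub_ne_finrank_altSub (by omega) U).symm]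
    norm_num

theorem charInner_rep2_eq_two_iff_commutant [Fintype G] (hd : 2 ≤ d) (U : G →* UGroup d) :
    charInner (rep2 U).character (rep2 U).character = 2 ↔
      ∀ X ∈ tensorSqCommutant U, ∃ a b : ℂ, X = a • 1 + b • swapMatrix d := by
  rw [← finrank_tensorSqCommutant_eq_two_iff hd, finrank_tensorSqCommutant, charInner_rep2,
    charPairing_character]
  norm_cast

theorem IsInducedBy.isUnitaryTwoDesign_iff [Fintype G] (hd : 2 ≤ d) {U : G →* UGroup d}
    {D : Finset (UGroup d)} (hD : IsInducedBy D U) : IsUnitaryTwoDesign D ↔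
      (symRep U).IsIrreducible ∧ (altRep U).IsIrreducible := by
  rw [← charInner_rep2_eq_two_iff hd, charInner_rep2_eq_two_iff_commutant hd]
  exact ⟨fun h => h.tensorSqCommutant_le (by omega) hD.1, hD.isUnitaryTwoDesign (by omega)⟩

theorem IsInducedBy.isIrreducible [Fintype G] (hd : 1 ≤ d) {U : G →* UGroup d}
    {D : Finset (UGroup d)} (hD : IsInducedBy D U) (h : IsUnitaryTwoDesign D) :
    (rep U).IsIrreducible :=
  isIrreducible_of_tensorSqCommutant hd (h.tensorSqCommutant_le hd hD.1)

theorem IsInducedBy.tfae [Fintype G] (hd : 2 ≤ d) {U : G →* UGroup d}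
    {D : Finset (UGroup d)} (hD : IsInducedBy D U) : List.TFAE
      [ IsUnitaryTwoDesign D,
        ∃ n ≤ 2, HasIrreducibleComponents (rep2 U) n,
        charInner (rep2 U).character (rep2 U).character = 2,
        IsIrreducibleCharacter (symSquare (rep U).character) ∧
          IsIrreducibleCharacter (altSquare (rep U).character) ] := by
  rw [hD.isUnitaryTwoDesign_iff hd, charInner_rep2_eq_two_iff hd, ← character_symSub,
    ← character_altSub, isIrreducibleCharacter_iff, isIrreducibleCharacter_iff]
  tfae_have 1 → 2 := fun h => ⟨2, le_rfl, hasIrreducibleComponents_rep2 h.1 h.2⟩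
  tfae_have 2 → 1 := fun ⟨n, hn, h⟩ =>
    have hc := isCompl_symSub_altSub U
    have hS := symSub_ne_bot (by omega) U
    have hA := altSub_ne_bot hd U
    ⟨h.isIrreducible_of_isCompl hn hc hS hA, h.isIrreducible_of_isCompl hn hc.symm hA hS⟩
  tfae_have 1 ↔ 3 := Iff.rfl
  tfae_have 1 ↔ 4 := Iff.rfl
  tfae_finish

theorem IsInducedBy.dvd_card [Fintype G] (hd : 2 ≤ d) {U : G →* UGroup d}
    {D : Finset (UGroup d)} (hD : IsInducedBy D U) (h : IsUnitaryTwoDesign D) :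
    d ∣ D.card ∧ d * (d + 1) / 2 ∣ D.card ∧ d * (d - 1) / 2 ∣ D.card := by
  have hirr := hD.isIrreducible (by omega) h
  obtain ⟨hS, hA⟩ := (hD.isUnitaryTwoDesign_iff hd).1 h
  have hscalar : ∀ n ∈ centerPreimage U, ∃ c : ℂ, rep U n = c • LinearMap.id := fun n hn => by
    obtain ⟨c, -, hc⟩ :=
      exists_coe_eq_smul_one_of_mem_repCenter (by omega) hirr (mem_centerPreimage.1 hn)
    refine ⟨c, ?_⟩
    change Matrix.toLin' (U n).1 = _
    rw [hc, map_smul, Matrix.toLin'_one]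
  have hscalar2 : ∀ σ : Subrepresentation (rep2 U), ∀ n ∈ centerPreimage U,
      ∃ c : ℂ, σ.toRepresentation n = c • LinearMap.id := fun σ n hn => by
    obtain ⟨c, hc⟩ := hscalar n hn
    have h2 : rep2 U n = (c * c) • LinearMap.id := by
      change TensorProduct.map (rep U n) (rep U n) = _
      rw [hc, TensorProduct.map_smul_left, TensorProduct.map_smul_right, TensorProduct.map_id,
        smul_smul]
    exact ⟨c * c, LinearMap.ext fun v => Subtype.ext (LinearMap.congr_fun h2 v)⟩
  have hT := hD.isCosetTransversal
  refine ⟨?_, ?_, ?_⟩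
  · simpa using hT.finrank_dvd_card hirr hscalar
  · rw [← finrank_symSub U, Nat.mul_div_cancel_left _ two_pos]
    exact hT.finrank_dvd_card hS (hscalar2 _)
  · rw [← finrank_altSub U, Nat.mul_div_cancel_left _ two_pos]
    exact hT.finrank_dvd_card hA (hscalar2 _)

theorem framePotential_matrixGroup_le_of_range_subset {H : Type*} [Group H] [Finite G] [Finite H]
    {U : G →* UGroup d} {V : H →* UGroup d} (h : Set.range U ⊆ Set.range V) :
    framePotential (matrixGroup V) ≤ framePotential (matrixGroup U) :=
  have hU := isCosetTransversal_matrixGroup U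
  framePotential_matrixGroup_le V hU.nonempty fun x hx => h (hU.mem_range x hx)

theorem IsInducedBy.framePotential_eq_matrixGroup [Finite G] (hd : 1 ≤ d) {U : G →* UGroup d}
    {D : Finset (UGroup d)} (hD : IsInducedBy D U) (h : (rep U).IsIrreducible) :
    framePotential D = framePotential (matrixGroup U) := by
  have := Fintype.ofFinite G
  exact Complex.ofReal_injective
    ((hD.framePotential_eq hd h).trans (framePotential_matrixGroup U).symm)

theorem exists_framePotential_matrixGroup_eq_intCast [Fintype G] (U : G →* UGroup d) :
    ∃ m : ℤ, framePotential (matrixGroup U) = m := by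
  have h := framePotential_matrixGroup U
  rw [charPairing_character] at h
  exact ⟨_, (by exact_mod_cast h :
    framePotential (matrixGroup U) = ((finrank ℂ (IntertwiningMap (rep2 U) (rep2 U)) : ℤ) : ℝ))⟩

theorem IsInducedBy.not_isUnitaryTwoDesign_of_real [Fintype G] (hd : 2 < d) {U : G →* UGroup d}
    {D : Finset (UGroup d)} (hD : IsInducedBy D U)
    (hreal : ∀ g, ((rep U).character g).im = 0) : ¬ IsUnitaryTwoDesign D := by
  intro h
  have hirr := hD.isIrreducible (by omega) h
  obtain ⟨hS, hA⟩ := (hD.isUnitaryTwoDesign_iff hd.le).1 h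
  let τ : Representation ℂ G ℂ := Representation.trivial ℂ G ℂ
  have hτ1 : ∀ g, τ.character g = 1 := fun g => by
    change LinearMap.trace ℂ ℂ (LinearMap.id) = 1
    simp
  have hτ : τ.IsIrreducible := by
    rw [isIrreducible_iff_charPairing, charPairing]
    simp only [hτ1, mul_one, Finset.sum_const, Finset.card_univ, nsmul_eq_mul,
      ← Nat.card_eq_fintype_card]
    exact inv_mul_cancel₀ (Nat.cast_ne_zero.2 Nat.card_pos.ne')
  have hfS := finrank_symSub U
  have hfA := finrank_altSub U
  have h3 : 3 * (3 - 1) ≤ d * (d - 1) := Nat.mul_le_mul hd (by omega)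
  have h4 : d * (d - 1) ≤ d * (d + 1) := Nat.mul_le_mul le_rfl (by omega)
  have hS1 : finrank ℂ (symSub U).toSubmodule ≠ finrank ℂ ℂ := by
    rw [finrank_self]
    omega
  have hA1 : finrank ℂ (altSub U).toSubmodule ≠ finrank ℂ ℂ := by
    rw [finrank_self]
    omega
  have hsum : charPairing (rep2 U).character τ.character = 0 := by
    have : (rep2 U).character =
        (symRep U).character + (altRep U).character :=
      funext fun g => (character_symSub_add_altSub U g).symm
    rw [this, charPairing_add_left, charPairing_eq_zero hS hτ hS1,
      charPairing_eq_zero hA hτ hA1, add_zero]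
  have hself := (isIrreducible_iff_charPairing _).1 hirr
  -- For real χ the summand χ(g)χ(g⁻¹) is χ(g)², the character of the tensor square paired with the
  -- trivial one.
  have : charPairing (rep U).character (rep U).character =
      charPairing (rep2 U).character τ.character := by
    rw [charPairing, charPairing]
    congr 1
    refine Finset.sum_congr rfl fun g _ => ?_
    rw [character_rep_inv, Complex.conj_eq_iff_im.2 (hreal g), hτ1, character_rep2, mul_one, sq]
  rw [this, hsum] at hself
  exact zero_ne_one hself

end SymAlt

end GroupDesign

theorem theorem3 {G : Type*} [Group G] [Fintype G] {d : ℕ} (hd : 1 ≤ d)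
    (U : G →* GroupDesign.UGroup d) (D : Finset (GroupDesign.UGroup d))
    (hD : GroupDesign.IsInducedBy D U) :
    -- equivalence of 1., 2., 3., 4.
    (2 ≤ d → List.TFAE
      [ GroupDesign.IsUnitaryTwoDesign D,
        ∃ n ≤ 2, GroupDesign.HasIrreducibleComponents (GroupDesign.rep2 U) n,
        GroupDesign.charInner (GroupDesign.rep2 U).character (GroupDesign.rep2 U).character = 2,
        GroupDesign.IsIrreducibleCharacter
            (GroupDesign.symSquare (GroupDesign.rep U).character) ∧
          GroupDesign.IsIrreducibleCharacter
            (GroupDesign.altSquare (GroupDesign.rep U).character) ]) ∧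
    -- 5. divisibility of the cardinality of a 2-design
    (2 ≤ d → GroupDesign.IsUnitaryTwoDesign D →
      d ∣ D.card ∧ d * (d + 1) / 2 ∣ D.card ∧ d * (d - 1) / 2 ∣ D.card) ∧
    -- 6. supergroups have frame potential at most that of their subgroups
    (∀ (H : Type*) [Group H] [Finite H] (V : H →* GroupDesign.UGroup d),
      Set.range U ⊆ Set.range V →
        GroupDesign.framePotential (GroupDesign.matrixGroup V) ≤
          GroupDesign.framePotential (GroupDesign.matrixGroup U) ∧
        ((GroupDesign.rep V).IsIrreducible →
          ∀ E : Finset (GroupDesign.UGroup d), GroupDesign.IsInducedBy E V →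
            GroupDesign.framePotential E ≤ GroupDesign.framePotential D)) ∧
    -- 7. the frame potential of a matrix group is an integer
    ((∃ m : ℤ, GroupDesign.framePotential (GroupDesign.matrixGroup U) = m) ∧
      ((GroupDesign.rep U).IsIrreducible → ∃ m : ℤ, GroupDesign.framePotential D = m)) ∧
    -- 8. irreducibility is necessary
    (GroupDesign.IsUnitaryTwoDesign D → (GroupDesign.rep U).IsIrreducible) ∧
    -- 9. no real representation in dimension greater than 2
    (2 < d →
      ((∀ g i j, ((U g : Matrix (Fin d) (Fin d) ℂ) i j).im = 0) ∨
        (∀ g, ((GroupDesign.rep U).character g).im = 0)) →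
      ¬ GroupDesign.IsUnitaryTwoDesign D) := by
  refine ⟨fun hd2 => hD.tfae hd2, fun hd2 h => hD.dvd_card hd2 h, ?_,
    ⟨GroupDesign.exists_framePotential_matrixGroup_eq_intCast U, fun hU => ?_⟩,
    hD.isIrreducible hd, ?_⟩
  · intro H _ _ V hUV
    refine ⟨GroupDesign.framePotential_matrixGroup_le_of_range_subset hUV, fun hV E hE => ?_⟩
    -- E has the potential of the whole matrix group of V, which contains D as a non-empty subset; D
    -- is thus compared directly.
    rw [hE.framePotential_eq_matrixGroup hd hV]
    exact GroupDesign.framePotential_matrixGroup_le V hD.isCosetTransversal.nonempty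
      fun x hx => hUV (hD.1 x hx)
  · rw [hD.framePotential_eq_matrixGroup hd hU]
    exact GroupDesign.exists_framePotential_matrixGroup_eq_intCast U
  · rintro hd2 (h | h)
    · refine hD.not_isUnitaryTwoDesign_of_real hd2 fun g => ?_
      rw [GroupDesign.character_rep, Matrix.trace, Complex.im_sum]
      exact Finset.sum_eq_zero fun i _ => h g i i
    · exact hD.not_isUnitaryTwoDesign_of_real hd2 h
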